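/- Let $\widehat R_0$ be a complete discrete valuation ring with fraction field $F_0$ and normalized valuation $v$; fix a real number $\alpha>1$, let $|a|=\alpha^{-v(a)}$ (with $|0|=0$) be the corresponding norm on $F_0$, and put $|a|=\max_i|a_i|$ for $a\in F_0^n$. Assume that $\widehat R_0$ contains a subring $T$ which is also a complete discrete valuation ring, and that some $t\in T$ is a uniformizer of both $T$ and $\widehat R_0$. Let $F_1,F_2$ be subfields of $F_0$ containing $T$, and let $\mathcal V\subseteq F_1\cap\widehat R_0$ and $\mathcal W\subseteq F_2\cap\widehat R_0$ be $t$-adically complete $T$-submodules with $\mathcal V+\mathcal W=\widehat R_0$. (a) Let $n\ge 0$, and let $f:\mathbb A^n_{F_0}\times\mathbb A^n_{F_0}\dashrightarrow\mathbb A^n_{F_0}$ be an $F_0$-rational map that is defined on a Zariski open set $U\subseteq\mathbb A^n_{F_0}\times\mathbb A^n_{F_0}$ containing the origin $(0,0)$. Suppose that for $u\in F_0^n$ one has $f(u,0)=u$ whenever $(u,0)\in U$, and $f(0,u)=u$ whenever $(0,u)\in U$. Then there is a real number $\varepsilon>0$ such that for every $a\in F_0^n$ with $|a|\le\varepsilon$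 there exist $v\in\mathcal V^n$ and $w\in\mathcal W^n$ with $(v,w)\in U(F_0)$ and $f(v,w)=a$. (b) Let $F$ be a subfield of $F_1\cap F_2$ that contains $T$, and assume that $F_1$ is $t$-adically dense in $F_0$ (that is, dense for the norm $|\cdot|$). Let $G$ be a rational connected linear algebraic group over $F$, that is, a connected affine group scheme of finite type over $F$ which is an integral $F$-variety whose function field is $F$-isomorphic to $F(x_1,\dots,x_m)$ for some $m\ge 0$. Then for every $g\in G(F_0)$ there exist $g_1\in G(F_1)$ and $g_2\in G(F_2)$ such that $g=g_1g_2$ in $G(F_0)$. -/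

import Mathlib

noncomputable section

/-- The norm `|a| = α ^ (-v(a))` (with `|0| = 0`) on the fraction field `F₀` of a discrete valuation
ring `R₀`, where `v` is the normalized discrete valuation of `R₀`.  Mathlib's valuation at the
maximal ideal is multiplicative with values in `ℤᵐ⁰`, so its `WithZero.log` at `a ≠ 0`
is `-v(a)`. -/
def adicNorm (R₀ : Type*) {F₀ : Type*} [CommRing R₀] [IsDomain R₀] [IsDiscreteValuationRing R₀]
    [Field F₀] [Algebra R₀ F₀] [IsFractionRing R₀ F₀] (α : ℝ) (a : F₀) : ℝ :=
  open Classical in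
  if a = 0 then 0
  else α ^ (WithZero.log ((IsDiscreteValuationRing.maximalIdeal R₀).valuation F₀ a))

/-- The maximum norm on `F₀ ^ n` (equal to `0` for `n = 0`). -/
def adicVecNorm (R₀ : Type*) {F₀ : Type*} [CommRing R₀] [IsDomain R₀] [IsDiscreteValuationRing R₀]
    [Field F₀] [Algebra R₀ F₀] [IsFractionRing R₀ F₀] (α : ℝ) {n : ℕ} (a : Fin n → F₀) : ℝ :=
  ⨆ i, adicNorm R₀ α (a i)

/-- The subset `S` of `F₀` is dense for the metric `|x - y|` on `F₀`. -/
def IsAdicallyDense (R₀ : Type*) {F₀ : Type*} [CommRing R₀] [IsDomain R₀]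
    [IsDiscreteValuationRing R₀] [Field F₀] [Algebra R₀ F₀] [IsFractionRing R₀ F₀] (α : ℝ)
    (S : Set F₀) : Prop :=
  ∀ x : F₀, ∀ ε : ℝ, 0 < ε → ∃ y ∈ S, adicNorm R₀ α (x - y) < ε

/-- The setting of the additive decomposition: `R₀` is a complete discrete valuation ring with
fraction field `F₀`, `T ⊆ R₀` is a subring that is also a complete discrete valuation ring,
`t ∈ T` is a uniformizer of both, `F₁` and `F₂` are subfields of `F₀` that contain `T`, and
`V ⊆ F₁ ∩ R₀`, `W ⊆ F₂ ∩ R₀` are `t`-adically complete `T`-submodules with `V + W = R₀`. -/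
structure AdditiveDecomposition {R₀ F₀ : Type*} [CommRing R₀] [IsDomain R₀]
    [IsDiscreteValuationRing R₀] [Field F₀] [Algebra R₀ F₀] [IsFractionRing R₀ F₀]
    (T : Subring R₀) (t : T) (F₁ F₂ : Subfield F₀) (V W : Submodule T R₀) : Prop where
  complete_R₀ : IsAdicComplete (IsLocalRing.maximalIdeal R₀) R₀
  irreducible_R₀ : Irreducible (t : R₀)
  isDVR_T : IsDiscreteValuationRing T
  complete_T : IsAdicComplete (IsLocalRing.maximalIdeal T) T
  irreducible_T : Irreducible t
  T_le_F₁ : ∀ x ∈ T, algebraMap R₀ F₀ x ∈ F₁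
  T_le_F₂ : ∀ x ∈ T, algebraMap R₀ F₀ x ∈ F₂
  V_le_F₁ : ∀ x ∈ V, algebraMap R₀ F₀ x ∈ F₁
  W_le_F₂ : ∀ x ∈ W, algebraMap R₀ F₀ x ∈ F₂
  complete_V : IsAdicComplete (Ideal.span {t}) V
  complete_W : IsAdicComplete (Ideal.span {t}) W
  sup_eq_top : V ⊔ W = ⊤

/-- The rational function `φ` on the affine space with coordinates indexed by `σ` is regular on
the open subscheme `U`: at every point of `U` it can be written as `p / q` with `q` not vanishing
at that point. -/
def IsRegularOn {k σ : Type*} [Field k] (φ : FractionRing (MvPolynomial σ k))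
    (U : TopologicalSpace.Opens (PrimeSpectrum (MvPolynomial σ k))) : Prop :=
  ∀ P ∈ U, ∃ p q : MvPolynomial σ k, q ∉ P.asIdeal ∧
    φ = algebraMap (MvPolynomial σ k) (FractionRing (MvPolynomial σ k)) p /
      algebraMap (MvPolynomial σ k) (FractionRing (MvPolynomial σ k)) q

/-- The rational function `φ` is regular at the `k`-rational point `c` and its value there
is `y`. -/
def HasValueAt {k σ : Type*} [Field k] (φ : FractionRing (MvPolynomial σ k)) (c : σ → k)
    (y : k) : Prop :=
  ∃ p q : MvPolynomial σ k, MvPolynomial.eval c q ≠ 0 ∧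
    φ = algebraMap (MvPolynomial σ k) (FractionRing (MvPolynomial σ k)) p /
      algebraMap (MvPolynomial σ k) (FractionRing (MvPolynomial σ k)) q ∧
    y = MvPolynomial.eval c p / MvPolynomial.eval c q

/-- The affine `k`-variety with coordinate ring `A` is rational: it is integral, and it is
birational to an affine space, i.e. its function field is `k`-isomorphic to a rational function
field `k(x₁, …, xₙ)`. -/
def IsRationalVariety (k A : Type*) [Field k] [CommRing A] [Algebra k A] : Prop :=
  IsDomain A ∧ ∃ n : ℕ, Nonempty (FractionRing A ≃ₐ[k] FractionRing (MvPolynomial (Fin n) k))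

/-- The affine group scheme `G = Spec A` over `k`, for a commutative Hopf algebra `A`, is a rational
connected linear algebraic group.  (A rational variety is geometrically integral, so that `G` is
automatically smooth over `k`.) -/
structure IsRationalConnectedGroup (k A : Type*) [Field k] [CommRing A] [HopfAlgebra k A] :
    Prop where
  finiteType : Algebra.FiniteType k A
  connected : ConnectedSpace (PrimeSpectrum A)
  rational : IsRationalVariety k A

/-- The group `G(E)` of `E`-rational points of the affine group scheme `G = Spec A`: the `k`-algebra
homomorphisms `A → E`, multiplied through the comultiplication of `A` (convolution). -/
abbrev GroupPoints (k A E : Type*) [Field k] [CommRing A] [HopfAlgebra k A] [Field E]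
    [Algebra k E] : Type _ :=
  WithConv (A →ₐ[k] E)

/-- The map `G(E) → G(E')` induced by a homomorphism `E → E'` of field extensions of `k`. -/
def GroupPoints.map {k A E E' : Type*} [Field k] [CommRing A] [HopfAlgebra k A] [Field E]
    [Algebra k E] [Field E'] [Algebra k E'] (φ : E →ₐ[k] E') (g : GroupPoints k A E) :
    GroupPoints k A E' :=
  WithConv.toConv (φ.comp g.ofConv)

end

section Adic

variable {R₀ F₀ : Type*} [CommRing R₀] [IsDomain R₀] [IsDiscreteValuationRing R₀]
  [Field F₀] [Algebra R₀ F₀] [IsFractionRing R₀ F₀]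

/-- An element of norm at most `α ^ (-N)` is a multiple of `ϖ ^ N`. -/
theorem exists_eq_pow_mul_of_adicNorm_le {α : ℝ} (hα : 1 < α) {ϖ : R₀} (hϖ : Irreducible ϖ)
    (N : ℕ) {a : F₀} (ha : adicNorm R₀ α a ≤ α ^ (-(N : ℤ))) :
    ∃ r : R₀, a = algebraMap R₀ F₀ ϖ ^ N * algebraMap R₀ F₀ r := by
  by_cases h0 : a = 0
  · exact ⟨0, by simp [h0]⟩
  have hπ : algebraMap R₀ F₀ ϖ ≠ 0 := by
    simpa using hϖ.ne_zero
  rw [adicNorm, if_neg h0, zpow_le_zpow_iff_right₀ hα] at ha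
  have hv := WithZero.le_exp_of_log_le ha
  have hvπ : (IsDiscreteValuationRing.maximalIdeal R₀).valuation F₀ (algebraMap R₀ F₀ ϖ) =
      WithZero.exp (-1) := by
    rw [IsDedekindDomain.HeightOneSpectrum.valuation_of_algebraMap]
    exact IsDedekindDomain.HeightOneSpectrum.intValuation_singleton _ hϖ.ne_zero
      hϖ.maximalIdeal_eq
  obtain ⟨r, hr⟩ := IsDiscreteValuationRing.exists_lift_of_le_one (A := R₀)
    (x := (algebraMap R₀ F₀ ϖ ^ N)⁻¹ * a) (by
      rw [map_mul, map_inv₀, map_pow, hvπ, ← WithZero.exp_nsmul]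
      refine (mul_le_mul_right hv _).trans ?_
      rw [← WithZero.exp_neg, ← WithZero.exp_add]
      simp)
  exact ⟨r, by rw [hr]; field_simp⟩

theorem adicNorm_le_adicVecNorm (α : ℝ) {n : ℕ} (a : Fin n → F₀) (i : Fin n) :
    adicNorm R₀ α (a i) ≤ adicVecNorm R₀ α a :=
  le_ciSup (f := fun i => adicNorm R₀ α (a i)) (Set.finite_range _).bddAbove i

/-- Every element of the fraction field has a denominator that is a power of a uniformizer. -/
theorem exists_pow_mul_eq_algebraMap {ϖ : R₀} (hϖ : Irreducible ϖ) (a : F₀) :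
    ∃ (K : ℕ) (r : R₀), algebraMap R₀ F₀ ϖ ^ K * a = algebraMap R₀ F₀ r := by
  obtain ⟨x, y, hy, rfl⟩ := IsFractionRing.div_surjective (A := R₀) a
  have hy0 : y ≠ 0 := nonZeroDivisors.ne_zero hy
  obtain ⟨K, u, hu⟩ := IsDiscreteValuationRing.eq_unit_mul_pow_irreducible hy0 hϖ
  refine ⟨K, x * (u⁻¹ : R₀ˣ), ?_⟩
  have hyF : algebraMap R₀ F₀ y ≠ 0 := by simpa using hy0
  rw [mul_div_assoc', div_eq_iff hyF, ← map_pow, ← map_mul, ← map_mul, hu]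
  congr 1
  rw [show x * ((u⁻¹ : R₀ˣ) : R₀) * (u * ϖ ^ K) = x * ϖ ^ K * (((u⁻¹ : R₀ˣ) : R₀) * u) by ring]
  simp [mul_comm]

/-- After rescaling the variables by a high power of a uniformizer, a polynomial without terms of
degree at most `e` becomes an integral polynomial multiplied by a power of the uniformizer. -/
theorem exists_integral_rescaling {τ : Type*} {ϖ : R₀} (hϖ : Irreducible ϖ) (e : ℕ)
    (P : MvPolynomial τ F₀) (hP : ∀ m, P.coeff m ≠ 0 → e + 1 ≤ m.degree) :
    ∃ M₀ : ℕ, ∀ M ≥ M₀, ∃ P' : MvPolynomial τ R₀, ∀ x : τ → R₀,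
      MvPolynomial.eval (fun i => algebraMap R₀ F₀ (ϖ ^ M * x i)) P =
        algebraMap R₀ F₀ (ϖ ^ (e * M + 1) * MvPolynomial.eval x P') := by
  choose K r hr using exists_pow_mul_eq_algebraMap (F₀ := F₀) hϖ
  refine ⟨P.support.sup fun m => K (P.coeff m) + 1, fun M hM => ?_⟩
  refine ⟨∑ m ∈ P.support, MvPolynomial.monomial m
    (ϖ ^ (M * m.degree - (e * M + 1) - K (P.coeff m)) * r (P.coeff m)), fun x => ?_⟩
  conv_lhs => rw [P.as_sum]
  rw [map_sum, map_sum, Finset.mul_sum, map_sum]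
  refine Finset.sum_congr rfl fun m hm => ?_
  have hK : K (P.coeff m) + 1 ≤ M :=
    (Finset.le_sup (f := fun m => K (P.coeff m) + 1) hm).trans hM
  have hdeg := hP m (MvPolynomial.mem_support_iff.1 hm)
  have hMd : M * (e + 1) ≤ M * m.degree := Nat.mul_le_mul_left _ hdeg
  obtain ⟨l, hl⟩ : ∃ l, M * m.degree = (e * M + 1) + K (P.coeff m) + l :=
    Nat.exists_eq_add_of_le (by nlinarith)
  have hl' : M * m.degree - (e * M + 1) - K (P.coeff m) = l := by omega
  rw [hl', MvPolynomial.eval_monomial, MvPolynomial.eval_monomial]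
  have hprod : (m.prod fun i k => algebraMap R₀ F₀ (ϖ ^ M * x i) ^ k) =
      algebraMap R₀ F₀ ϖ ^ (M * m.degree) * algebraMap R₀ F₀ (m.prod fun i k => x i ^ k) := by
    simp only [Finsupp.prod, map_mul, map_pow, map_prod, mul_pow, Finset.prod_mul_distrib,
      Finsupp.degree_apply, ← pow_mul]
    rw [Finset.prod_pow_eq_pow_sum, ← Finset.mul_sum]
  rw [hprod, hl]
  simp only [map_mul, map_pow, ← hr]
  ring

/-- Evaluation of a polynomial respects congruences. -/
theorem dvd_eval_sub_eval {τ R : Type*} [CommRing R] (P : MvPolynomial τ R) (d : R)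
    {x y : τ → R} (h : ∀ i, d ∣ x i - y i) :
    d ∣ MvPolynomial.eval x P - MvPolynomial.eval y P := by
  rw [← Ideal.mem_span_singleton, ← Ideal.Quotient.eq, ← MvPolynomial.eval₂_id,
    ← MvPolynomial.eval₂_id, MvPolynomial.eval₂_comp_left, MvPolynomial.eval₂_comp_left]
  congr 1
  funext i
  exact Ideal.Quotient.eq.2 (Ideal.mem_span_singleton.2 (h i))

/-- Near a point where it does not vanish, a polynomial is, up to the value at this point, an
integral polynomial function that is congruent to one. -/
theorem exists_unit_rescaling {τ : Type*} {ϖ : R₀} (hϖ : Irreducible ϖ)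
    (Q : MvPolynomial τ F₀) (hQ : Q.coeff 0 ≠ 0) :
    ∃ M₀ : ℕ, ∀ M ≥ M₀, ∃ Q' : MvPolynomial τ R₀, ∀ x : τ → R₀,
      MvPolynomial.eval (fun i => algebraMap R₀ F₀ (ϖ ^ M * x i)) Q =
        Q.coeff 0 * algebraMap R₀ F₀ (1 + ϖ * MvPolynomial.eval x Q') := by
  obtain ⟨M₀, hM₀⟩ := exists_integral_rescaling hϖ 0
    (MvPolynomial.C (Q.coeff 0)⁻¹ * Q - 1) (fun m hm => by
      rcases Nat.eq_zero_or_pos m.degree with h | h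
      · have : m = 0 := (Finsupp.degree_eq_zero_iff m).1 h
        subst this
        simp [hQ] at hm
      · omega)
  refine ⟨M₀, fun M hM => ?_⟩
  obtain ⟨Q', hQ'⟩ := hM₀ M hM
  refine ⟨Q', fun x => ?_⟩
  have h := hQ' x
  rw [map_sub, map_mul, MvPolynomial.eval_C, map_one, zero_mul, zero_add, pow_one,
    sub_eq_iff_eq_add'] at h
  rw [map_add, map_one, ← h, mul_inv_cancel_left₀ hQ]

theorem isUnit_one_add_mul {ϖ : R₀} (hϖ : Irreducible ϖ) (r : R₀) : IsUnit (1 + ϖ * r) := by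
  by_contra h
  have h1 : (1 + ϖ * r) ∈ IsLocalRing.maximalIdeal R₀ := h
  have h2 : ϖ * r ∈ IsLocalRing.maximalIdeal R₀ :=
    Ideal.mul_mem_right _ _ hϖ.not_isUnit
  have h3 := (Ideal.add_mem_iff_left _ h2).1 h1
  exact h3 isUnit_one

end Adic

section Decomposition

/-- Limits of sequences with `t`-adically small increments in a `t`-adically complete module. -/
theorem exists_limit_of_increments {R M : Type*} [CommRing R] [AddCommGroup M] [Module R M] (t : R)
    [IsAdicComplete (Ideal.span {t}) M] (f : ℕ → M) (hf : ∀ j, ∃ u, f (j + 1) = f j + t ^ j • u) :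
    ∃ L : M, ∀ j, ∃ u, f j = L + t ^ j • u := by
  have key : ∀ j (x y : M), x ≡ y [SMOD (Ideal.span {t} ^ j • ⊤ : Submodule R M)] ↔
      ∃ u, x = y + t ^ j • u := by
    intro j x y
    rw [SModEq.sub_mem, Ideal.span_singleton_pow, Submodule.ideal_span_singleton_smul,
      Submodule.mem_smul_pointwise_iff_exists]
    simp only [Submodule.mem_top, true_and, eq_sub_iff_add_eq]
    exact exists_congr fun u => by rw [add_comm, eq_comm]
  have hcauchy : ∀ {m n : ℕ}, m ≤ n →
      f m ≡ f n [SMOD (Ideal.span {t} ^ m • ⊤ : Submodule R M)] := by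
    intro m n hmn
    induction n, hmn using Nat.le_induction with
    | base => exact SModEq.refl _
    | succ n hmn ih =>
      refine ih.trans (SModEq.symm ((key _ _ _).2 ?_))
      obtain ⟨u, hu⟩ := hf n
      obtain ⟨l, rfl⟩ := Nat.exists_eq_add_of_le hmn
      exact ⟨t ^ l • u, by rw [hu, smul_smul, pow_add]⟩
  obtain ⟨L, hL⟩ := IsPrecomplete.prec (I := Ideal.span {t}) inferInstance hcauchy
  exact ⟨L, fun j => (key _ _ _).1 (hL j)⟩

variable {R₀ F₀ : Type*} [CommRing R₀] [IsDomain R₀] [IsDiscreteValuationRing R₀]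
  [Field F₀] [Algebra R₀ F₀] [IsFractionRing R₀ F₀] {T : Subring R₀} {t : T}
  {F₁ F₂ : Subfield F₀} {V W : Submodule T R₀}

/-- A perturbation, divisible by `t` and compatible with congruences, of the addition map
`Vⁿ × Wⁿ → R₀ⁿ` is surjective. -/
theorem AdditiveDecomposition.exists_add_add_mul_eq (hyp : AdditiveDecomposition T t F₁ F₂ V W)
    {ι : Type*} (G : (ι → R₀) → (ι → R₀) → ι → R₀)
    (hG : ∀ (k : ℕ) (v v' w w' : ι → R₀), (∀ i, (t : R₀) ^ k ∣ v i - v' i) →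
      (∀ i, (t : R₀) ^ k ∣ w i - w' i) → ∀ i, (t : R₀) ^ k ∣ G v w i - G v' w' i)
    (a : ι → R₀) :
    ∃ v w : ι → R₀, (∀ i, v i ∈ V) ∧ (∀ i, w i ∈ W) ∧ ∀ i, v i + w i + t * G v w i = a i := by
  have := hyp.complete_V
  have := hyp.complete_W
  have hsplit : ∀ r : R₀, ∃ (x : V) (y : W), (x : R₀) + y = r := by
    intro r
    obtain ⟨x, hx, y, hy, h⟩ := Submodule.mem_sup.1 (hyp.sup_eq_top ▸ Submodule.mem_top (x := r))
    exact ⟨⟨x, hx⟩, ⟨y, hy⟩, h⟩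
  let Φ : (ι → V) × (ι → W) → ι → R₀ := fun p i =>
    (p.1 i : R₀) + p.2 i + t * G (fun i => p.1 i) (fun i => p.2 i) i
  let P : ℕ → (ι → V) × (ι → W) → Prop := fun j p => ∀ i, (t : R₀) ^ j ∣ a i - Φ p i
  have hsmulV : ∀ (j : ℕ) (x : V), ((t ^ j • x : V) : R₀) = (t : R₀) ^ j * x := by
    intro j x
    simp [Subring.smul_def]
  have hsmulW : ∀ (j : ℕ) (x : W), ((t ^ j • x : W) : R₀) = (t : R₀) ^ j * x := by
    intro j x
    simp [Subring.smul_def]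
  have step : ∀ (j : ℕ) (p : {p // P j p}), ∃ p' : {p // P (j + 1) p},
      (∀ i, ∃ u, p'.1.1 i = p.1.1 i + t ^ j • u) ∧ ∀ i, ∃ u, p'.1.2 i = p.1.2 i + t ^ j • u := by
    rintro j ⟨p, hp⟩
    choose d hd using id hp
    choose x y hxy using hsplit
    refine ⟨⟨(fun i => p.1 i + t ^ j • x (d i), fun i => p.2 i + t ^ j • y (d i)), fun i => ?_⟩,
      fun i => ⟨_, rfl⟩, fun i => ⟨_, rfl⟩⟩
    obtain ⟨e, he⟩ := hG j (fun i => (p.1 i + t ^ j • x (d i) : V)) (fun i => p.1 i)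
      (fun i => (p.2 i + t ^ j • y (d i) : W)) (fun i => p.2 i)
      (fun i => ⟨x (d i), by simp [Subring.smul_def]⟩)
      (fun i => ⟨y (d i), by simp [Subring.smul_def]⟩) i
    refine ⟨-e, ?_⟩
    have hdi := hd i
    have hx := hxy (d i)
    simp only [Φ, Submodule.coe_add, hsmulV, hsmulW] at hdi he ⊢
    rw [sub_eq_iff_eq_add] at he
    rw [he]
    linear_combination hdi - (t : R₀) ^ j * hx
  choose next hV hW using step
  let s : ∀ j, {p // P j p} := fun j => Nat.rec ⟨(0, 0), fun i => by simp⟩ next j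
  have hsV : ∀ i, ∃ L : V, ∀ j, ∃ u, (s j).1.1 i = L + t ^ j • u := fun i =>
    exists_limit_of_increments t _ fun j => hV j (s j) i
  have hsW : ∀ i, ∃ L : W, ∀ j, ∃ u, (s j).1.2 i = L + t ^ j • u := fun i =>
    exists_limit_of_increments t _ fun j => hW j (s j) i
  choose v hv using hsV
  choose w hw using hsW
  refine ⟨fun i => v i, fun i => w i, fun i => (v i).2, fun i => (w i).2, fun i => ?_⟩
  have hdvd : ∀ j, (t : R₀) ^ j ∣ a i - ((v i : R₀) + w i +
      t * G (fun i => v i) (fun i => w i) i) := by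
    intro j
    have h1 : ∀ i, (t : R₀) ^ j ∣ ((s j).1.1 i : R₀) - v i := fun i => by
      obtain ⟨u, hu⟩ := hv i j
      exact ⟨u, by rw [hu, Submodule.coe_add, hsmulV]; ring⟩
    have h2 : ∀ i, (t : R₀) ^ j ∣ ((s j).1.2 i : R₀) - w i := fun i => by
      obtain ⟨u, hu⟩ := hw i j
      exact ⟨u, by rw [hu, Submodule.coe_add, hsmulW]; ring⟩
    have h3 := (hG j _ _ _ _ h1 h2 i).mul_left (t : R₀)
    have h4 := (((s j).2 i).add (h1 i)).add ((h2 i).add h3)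
    convert h4 using 1
    simp only [Φ]
    ring
  have hzero : a i - ((v i : R₀) + w i + t * G (fun i => v i) (fun i => w i) i) = 0 := by
    by_contra hne
    obtain ⟨j, hj⟩ := FiniteMultiplicity.of_not_isUnit hyp.irreducible_R₀.not_isUnit hne
    exact hj (hdvd _)
  exact (sub_eq_zero.1 hzero).symm

theorem infinite_of_irreducible {R : Type*} [CommRing R] [IsDomain R] {ϖ : R}
    (hϖ : Irreducible ϖ) : Infinite R :=
  Infinite.of_injective (fun n : ℕ => ϖ ^ n) (pow_injective_of_not_isUnit hϖ.not_isUnit hϖ.ne_zero)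

end Decomposition

section PolynomialCoordinates

/-- A polynomial that vanishes wherever another nonzero polynomial does not is zero. -/
theorem MvPolynomial.eq_zero_of_eval_ne_zero_imp {k σ : Type*} [Field k] [Infinite k]
    {p s : MvPolynomial σ k} (hs : s ≠ 0)
    (h : ∀ x, MvPolynomial.eval x s ≠ 0 → MvPolynomial.eval x p = 0) : p = 0 := by
  have : s * p = 0 := MvPolynomial.funext fun x => by
    by_cases hx : MvPolynomial.eval x s = 0
    · simp [hx]
    · simp [h x hx]
  exact (mul_eq_zero.1 this).resolve_left hs

theorem MvPolynomial.exists_eval_ne_zero {k σ : Type*} [Field k] [Infinite k]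
    {p : MvPolynomial σ k} (hp : p ≠ 0) : ∃ x, MvPolynomial.eval x p ≠ 0 := by
  by_contra! h
  exact hp (MvPolynomial.funext fun x => by simpa using h x)

/-- If a polynomial vanishes on the coordinate subspace where the variables in `S` are zero, then
each of its monomials involves a variable in `S`. -/
theorem MvPolynomial.exists_mem_of_bind₁_eq_zero {k σ τ : Type*} [Field k] (f : σ → τ) (S : Set τ)
    (ρ : τ → MvPolynomial σ k) (hS : ∀ i ∈ S, ρ i = 0)
    (hS' : ∀ i ∉ S, MvPolynomial.rename f (ρ i) = MvPolynomial.X i) {P : MvPolynomial τ k}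
    (hP : MvPolynomial.bind₁ ρ P = 0) {m : τ →₀ ℕ} (hm : m ∈ P.support) : ∃ i ∈ S, m i ≠ 0 := by
  have hmem : P ∈ Ideal.span (MvPolynomial.X '' S : Set (MvPolynomial τ k)) := by
    have hhom : (Ideal.Quotient.mkₐ k (Ideal.span (MvPolynomial.X '' S))).comp
        ((MvPolynomial.rename f).comp (MvPolynomial.bind₁ ρ)) =
          Ideal.Quotient.mkₐ k (Ideal.span (MvPolynomial.X '' S : Set (MvPolynomial τ k))) := by
      refine MvPolynomial.algHom_ext fun i => ?_
      by_cases hi : i ∈ S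
      · have : MvPolynomial.X i ∈ Ideal.span (MvPolynomial.X '' S : Set (MvPolynomial τ k)) :=
          Ideal.subset_span ⟨i, hi, rfl⟩
        simp [hS i hi, (Ideal.Quotient.eq_zero_iff_mem.2 this)]
      · simp [hS' i hi]
    have h := DFunLike.congr_fun hhom P
    rw [AlgHom.comp_apply, AlgHom.comp_apply, hP, map_zero, map_zero] at h
    exact Ideal.Quotient.eq_zero_iff_mem.1 h.symm
  exact MvPolynomial.mem_ideal_span_X_image.1 hmem m hm

theorem MvPolynomial.eval_bind₁ {k σ τ : Type*} [CommRing k] (ρ : τ → MvPolynomial σ k)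
    (u : σ → k) (P : MvPolynomial τ k) :
    MvPolynomial.eval u (MvPolynomial.bind₁ ρ P) =
      MvPolynomial.eval (fun i => MvPolynomial.eval u (ρ i)) P :=
  MvPolynomial.eval₂Hom_bind₁ _ _ _ _

/-- A polynomial in two groups of variables that vanishes, near the origin, when either of the two
groups is zero has no terms of degree at most one. -/
theorem MvPolynomial.two_le_degree_of_eval_eq_zero {k ι : Type*} [Field k] [Infinite k]
    {P s : MvPolynomial (ι ⊕ ι) k} (hs : MvPolynomial.eval 0 s ≠ 0)
    (h₁ : ∀ u, MvPolynomial.eval (Sum.elim u 0) s ≠ 0 → MvPolynomial.eval (Sum.elim u 0) P = 0)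
    (h₂ : ∀ u, MvPolynomial.eval (Sum.elim 0 u) s ≠ 0 → MvPolynomial.eval (Sum.elim 0 u) P = 0)
    (m : ι ⊕ ι →₀ ℕ) (hm : P.coeff m ≠ 0) : 2 ≤ m.degree := by
  have e₁ : ∀ (u : ι → k) (Q : MvPolynomial (ι ⊕ ι) k),
      MvPolynomial.eval u (MvPolynomial.bind₁ (Sum.elim MvPolynomial.X 0) Q) =
        MvPolynomial.eval (Sum.elim u 0) Q := fun u Q => by
    rw [MvPolynomial.eval_bind₁]
    congr 2
    funext i
    cases i <;> simp
  have e₂ : ∀ (u : ι → k) (Q : MvPolynomial (ι ⊕ ι) k),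
      MvPolynomial.eval u (MvPolynomial.bind₁ (Sum.elim 0 MvPolynomial.X) Q) =
        MvPolynomial.eval (Sum.elim 0 u) Q := fun u Q => by
    rw [MvPolynomial.eval_bind₁]
    congr 2
    funext i
    cases i <;> simp
  have hz : Sum.elim (0 : ι → k) (0 : ι → k) = 0 := Sum.elim_zero_zero
  have b₁ : MvPolynomial.bind₁ (Sum.elim MvPolynomial.X 0) P = (0 : MvPolynomial ι k) :=
    MvPolynomial.eq_zero_of_eval_ne_zero_imp
      (s := MvPolynomial.bind₁ (Sum.elim MvPolynomial.X 0) s)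
      (fun h => hs (by rw [← hz, ← e₁, h, map_zero]))
      (fun u hu => by rw [e₁] at hu ⊢; exact h₁ u hu)
  have b₂ : MvPolynomial.bind₁ (Sum.elim 0 MvPolynomial.X) P = (0 : MvPolynomial ι k) :=
    MvPolynomial.eq_zero_of_eval_ne_zero_imp
      (s := MvPolynomial.bind₁ (Sum.elim 0 MvPolynomial.X) s)
      (fun h => hs (by rw [← hz, ← e₂, h, map_zero]))
      (fun u hu => by rw [e₂] at hu ⊢; exact h₂ u hu)
  obtain ⟨_, ⟨i, rfl⟩, hi⟩ := MvPolynomial.exists_mem_of_bind₁_eq_zero Sum.inl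
    (Set.range Sum.inr) _ (by rintro _ ⟨i, rfl⟩; simp) (by rintro (i | i) <;> simp) b₁
    (MvPolynomial.mem_support_iff.2 hm)
  obtain ⟨_, ⟨j, rfl⟩, hj⟩ := MvPolynomial.exists_mem_of_bind₁_eq_zero Sum.inr
    (Set.range Sum.inl) _ (by rintro _ ⟨i, rfl⟩; simp) (by rintro (i | i) <;> simp) b₂
    (MvPolynomial.mem_support_iff.2 hm)
  classical
  have hsub : ({Sum.inr i, Sum.inl j} : Finset (ι ⊕ ι)) ⊆ m.support := by
    intro x hx
    simp only [Finset.mem_insert, Finset.mem_singleton] at hx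
    rcases hx with rfl | rfl <;> simpa
  have := Finset.sum_le_sum_of_subset (f := m) hsub
  rw [Finset.sum_pair (by simp)] at this
  rw [Finsupp.degree_apply]
  omega

end PolynomialCoordinates

section SmallVectors

variable {R₀ F₀ : Type*} [CommRing R₀] [IsDomain R₀] [IsDiscreteValuationRing R₀]
  [Field F₀] [Algebra R₀ F₀] [IsFractionRing R₀ F₀] {T : Subring R₀} {t : T}
  {F₁ F₂ : Subfield F₀} {V W : Submodule T R₀}

/-- The decomposition of small vectors by a rational map `(pᵢ / qᵢ)ᵢ`, in terms of polynomials. -/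
theorem AdditiveDecomposition.exists_of_polynomials (hyp : AdditiveDecomposition T t F₁ F₂ V W)
    {ι : Type*} [Finite ι] (p q : ι → MvPolynomial (ι ⊕ ι) F₀) (s : MvPolynomial (ι ⊕ ι) F₀)
    (hq : ∀ i, MvPolynomial.eval 0 (q i) ≠ 0) (hs : MvPolynomial.eval 0 s ≠ 0)
    (h₁ : ∀ u, MvPolynomial.eval (Sum.elim u 0) s ≠ 0 → ∀ i,
      MvPolynomial.eval (Sum.elim u 0) (p i) = u i * MvPolynomial.eval (Sum.elim u 0) (q i))
    (h₂ : ∀ u, MvPolynomial.eval (Sum.elim 0 u) s ≠ 0 → ∀ i,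
      MvPolynomial.eval (Sum.elim 0 u) (p i) = u i * MvPolynomial.eval (Sum.elim 0 u) (q i)) :
    ∃ N : ℕ, ∀ a : ι → R₀, ∃ v w : ι → R₀, (∀ i, v i ∈ V) ∧ (∀ i, w i ∈ W) ∧
      MvPolynomial.eval (Sum.elim (algebraMap R₀ F₀ ∘ v) (algebraMap R₀ F₀ ∘ w)) s ≠ 0 ∧
      ∀ i, MvPolynomial.eval (Sum.elim (algebraMap R₀ F₀ ∘ v) (algebraMap R₀ F₀ ∘ w)) (q i) ≠ 0 ∧
        MvPolynomial.eval (Sum.elim (algebraMap R₀ F₀ ∘ v) (algebraMap R₀ F₀ ∘ w)) (p i) =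
          algebraMap R₀ F₀ (t ^ N * a i) *
            MvPolynomial.eval (Sum.elim (algebraMap R₀ F₀ ∘ v) (algebraMap R₀ F₀ ∘ w)) (q i) := by
  have := Fintype.ofFinite ι
  have hϖ := hyp.irreducible_R₀
  have : Infinite R₀ := infinite_of_irreducible hϖ
  have : Infinite F₀ := Infinite.of_injective _ (IsFractionRing.injective R₀ F₀)
  have hcoeff : ∀ Q : MvPolynomial (ι ⊕ ι) F₀, MvPolynomial.eval 0 Q = Q.coeff 0 := fun Q => by
    rw [MvPolynomial.eval_zero, MvPolynomial.constantCoeff_eq]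
  rw [hcoeff] at hs
  simp only [hcoeff] at hq
  let P : ι → MvPolynomial (ι ⊕ ι) F₀ := fun i => MvPolynomial.C ((q i).coeff 0)⁻¹ *
    (p i - (MvPolynomial.X (Sum.inl i) + MvPolynomial.X (Sum.inr i)) * q i)
  have hP : ∀ i m, (P i).coeff m ≠ 0 → 1 + 1 ≤ m.degree := fun i =>
    MvPolynomial.two_le_degree_of_eval_eq_zero (s := s) (by rwa [hcoeff])
      (fun u hu => by simp [P, h₁ u hu i]) (fun u hu => by simp [P, h₂ u hu i])
  choose MP hMP using fun i => exists_integral_rescaling hϖ 1 (P i) (hP i)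
  choose MQ hMQ using fun i => exists_unit_rescaling hϖ (q i) (hq i)
  obtain ⟨MS, hMS⟩ := exists_unit_rescaling hϖ s hs
  let N := Finset.univ.sup MP ⊔ Finset.univ.sup MQ ⊔ MS
  have hNP : ∀ i, MP i ≤ N := fun i => (Finset.le_sup (Finset.mem_univ i)).trans
    (le_sup_left.trans le_sup_left)
  have hNQ : ∀ i, MQ i ≤ N := fun i => (Finset.le_sup (Finset.mem_univ i)).trans
    (le_sup_right.trans le_sup_left)
  choose P' hP' using fun i => hMP i N (hNP i)
  choose Q' hQ' using fun i => hMQ i N (hNQ i)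
  obtain ⟨S', hS'⟩ := hMS N le_sup_right
  refine ⟨N, fun a => ?_⟩
  let D : (ι → R₀) → (ι → R₀) → ι → R₀ := fun v w i =>
    1 + t * MvPolynomial.eval (Sum.elim v w) (Q' i)
  have hD : ∀ v w i, IsUnit (D v w i) := fun v w i => isUnit_one_add_mul hϖ _
  have hcongr : ∀ (k : ℕ) (v v' w w' : ι → R₀), (∀ i, (t : R₀) ^ k ∣ v i - v' i) →
      (∀ i, (t : R₀) ^ k ∣ w i - w' i) → ∀ Q : MvPolynomial (ι ⊕ ι) R₀,
      (t : R₀) ^ k ∣ MvPolynomial.eval (Sum.elim v w) Q - MvPolynomial.eval (Sum.elim v' w') Q :=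
    fun k v v' w w' hv hw Q => dvd_eval_sub_eval Q _ (by rintro (i | i) <;> simp [hv, hw])
  obtain ⟨v, w, hv, hw, heq⟩ := hyp.exists_add_add_mul_eq
    (fun v w i => MvPolynomial.eval (Sum.elim v w) (P' i) * Ring.inverse (D v w i))
    (fun k v v' w w' hv hw i => by
      have e1 := hcongr k v v' w w' hv hw (P' i)
      have e2 := hcongr k v v' w w' hv hw (Q' i)
      have d1 := Ring.mul_inverse_cancel _ (hD v w i)
      have d2 := Ring.mul_inverse_cancel _ (hD v' w' i)
      set x := Ring.inverse (D v w i)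
      set y := Ring.inverse (D v' w' i)
      have key : MvPolynomial.eval (Sum.elim v w) (P' i) * x -
          MvPolynomial.eval (Sum.elim v' w') (P' i) * y =
          (MvPolynomial.eval (Sum.elim v w) (P' i) -
            MvPolynomial.eval (Sum.elim v' w') (P' i)) * x -
          MvPolynomial.eval (Sum.elim v' w') (P' i) * t * x * y *
          (MvPolynomial.eval (Sum.elim v w) (Q' i) -
            MvPolynomial.eval (Sum.elim v' w') (Q' i)) := by
        simp only [D] at d1 d2
        linear_combination MvPolynomial.eval (Sum.elim v' w') (P' i) * (y * d1 - x * d2)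
      rw [key]
      exact dvd_sub (e1.mul_right _) (e2.mul_left _)) a
  have hpt : Sum.elim (algebraMap R₀ F₀ ∘ fun i => (t : R₀) ^ N * v i)
      (algebraMap R₀ F₀ ∘ fun i => (t : R₀) ^ N * w i) =
      fun i => algebraMap R₀ F₀ ((t : R₀) ^ N * Sum.elim v w i) := by
    funext i
    cases i <;> simp
  have hne : ∀ r : R₀, algebraMap R₀ F₀ (1 + t * r) ≠ 0 := fun r =>
    ((isUnit_one_add_mul hϖ r).map (algebraMap R₀ F₀)).ne_zero
  refine ⟨fun i => t ^ N * v i, fun i => t ^ N * w i, fun i => V.smul_mem (t ^ N) (hv i),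
    fun i => W.smul_mem (t ^ N) (hw i), ?_, fun i => ?_⟩
  · rw [hpt, hS']
    exact mul_ne_zero hs (hne _)
  · have hPi := hP' i (Sum.elim v w)
    have hQi := hQ' i (Sum.elim v w)
    rw [← hpt] at hPi hQi
    refine ⟨by rw [hQi]; exact mul_ne_zero (hq i) (hne _), ?_⟩
    have hDi := congrArg (algebraMap R₀ F₀) (Ring.mul_inverse_cancel _ (hD v w i))
    have ha := congrArg (algebraMap R₀ F₀) (heq i)
    simp only [P, map_mul, map_sub, map_add, MvPolynomial.eval_C, MvPolynomial.eval_X,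
      Sum.elim_inl, Sum.elim_inr, Function.comp_apply, D, one_mul, pow_add, pow_one, map_pow,
      map_one] at hPi hQi hDi ha ⊢
    rw [hQi, inv_mul_eq_iff_eq_mul₀ (hq i), sub_eq_iff_eq_add] at hPi
    rw [hPi, hQi, ← ha]
    linear_combination (-(algebraMap R₀ F₀ t ^ N * (q i).coeff 0 * algebraMap R₀ F₀ t *
      algebraMap R₀ F₀ (MvPolynomial.eval (Sum.elim v w) (P' i)))) * hDi

theorem MvPolynomial.mem_pointToPoint_asIdeal {k σ : Type*} [Field k] (c : σ → k)
    (p : MvPolynomial σ k) : p ∈ (MvPolynomial.pointToPoint (k := k) c).asIdeal ↔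
      MvPolynomial.eval c p = 0 := by
  change p ∈ MvPolynomial.vanishingIdeal k {c} ↔ _
  simp [MvPolynomial.mem_vanishingIdeal_iff, MvPolynomial.aeval_eq_eval]

/-- An open set that contains a rational point contains a basic open neighbourhood of it. -/
theorem MvPolynomial.exists_eval_ne_zero_of_pointToPoint_mem {k σ : Type*} [Field k]
    (U : TopologicalSpace.Opens (PrimeSpectrum (MvPolynomial σ k))) {c : σ → k}
    (hc : MvPolynomial.pointToPoint c ∈ U) : ∃ s : MvPolynomial σ k, MvPolynomial.eval c s ≠ 0 ∧
      ∀ x, MvPolynomial.eval x s ≠ 0 → MvPolynomial.pointToPoint x ∈ U := by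
  obtain ⟨_, ⟨s, rfl⟩, hcs, hsU⟩ :=
    PrimeSpectrum.isTopologicalBasis_basic_opens.exists_subset_of_mem_open hc U.isOpen
  refine ⟨s, fun h => hcs ((MvPolynomial.mem_pointToPoint_asIdeal c s).2 h), fun x hx => ?_⟩
  exact hsU fun h => hx ((MvPolynomial.mem_pointToPoint_asIdeal x s).1 h)

/-- The value of a rational function at a point, in terms of any presentation as a fraction. -/
theorem HasValueAt.eval_eq_mul {k σ : Type*} [Field k] {φ : FractionRing (MvPolynomial σ k)}
    {c : σ → k} {y : k} (h : HasValueAt φ c y) {p q : MvPolynomial σ k} (hq : q ≠ 0)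
    (hφ : φ = algebraMap (MvPolynomial σ k) (FractionRing (MvPolynomial σ k)) p /
      algebraMap (MvPolynomial σ k) (FractionRing (MvPolynomial σ k)) q) :
    MvPolynomial.eval c p = y * MvPolynomial.eval c q := by
  obtain ⟨p', q', hq', hφ', rfl⟩ := h
  have hq'0 : q' ≠ 0 := fun h0 => hq' (by simp [h0])
  have inj := IsFractionRing.injective (MvPolynomial σ k) (FractionRing (MvPolynomial σ k))
  rw [hφ, div_eq_div_iff ((map_ne_zero_iff _ inj).2 hq) ((map_ne_zero_iff _ inj).2 hq'0),
    ← map_mul, ← map_mul] at hφ'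
  have := congrArg (MvPolynomial.eval c) (inj hφ')
  rw [map_mul, map_mul] at this
  field_simp
  exact this

/-- Decomposition of small vectors by a rational map that restricts to the identity on both
factors. -/
theorem AdditiveDecomposition.exists_of_rationalMap (hyp : AdditiveDecomposition T t F₁ F₂ V W)
    {α : ℝ} (hα : 1 < α) (n : ℕ) (f : Fin n → FractionRing (MvPolynomial (Fin n ⊕ Fin n) F₀))
    (U : TopologicalSpace.Opens (PrimeSpectrum (MvPolynomial (Fin n ⊕ Fin n) F₀)))
    (hf : ∀ i, IsRegularOn (f i) U)
    (h0 : MvPolynomial.pointToPoint (Sum.elim (0 : Fin n → F₀) 0) ∈ U)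
    (h₁ : ∀ u : Fin n → F₀, MvPolynomial.pointToPoint (Sum.elim u 0) ∈ U →
      ∀ i, HasValueAt (f i) (Sum.elim u 0) (u i))
    (h₂ : ∀ u : Fin n → F₀, MvPolynomial.pointToPoint (Sum.elim 0 u) ∈ U →
      ∀ i, HasValueAt (f i) (Sum.elim 0 u) (u i)) :
    ∃ ε : ℝ, 0 < ε ∧ ∀ a : Fin n → F₀, adicVecNorm R₀ α a ≤ ε →
      ∃ v w : Fin n → R₀, (∀ i, v i ∈ V) ∧ (∀ i, w i ∈ W) ∧
        MvPolynomial.pointToPoint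
          (Sum.elim (algebraMap R₀ F₀ ∘ v) (algebraMap R₀ F₀ ∘ w)) ∈ U ∧
        ∀ i, HasValueAt (f i)
          (Sum.elim (algebraMap R₀ F₀ ∘ v) (algebraMap R₀ F₀ ∘ w)) (a i) := by
  choose p q hq hpq using fun i => hf i _ h0
  simp only [MvPolynomial.mem_pointToPoint_asIdeal] at hq
  have hq0 : ∀ i, q i ≠ 0 := fun i h => hq i (by simp [h])
  obtain ⟨s, hs, hsU⟩ := MvPolynomial.exists_eval_ne_zero_of_pointToPoint_mem U h0
  simp only [Sum.elim_zero_zero] at hq hs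
  obtain ⟨N, hN⟩ := hyp.exists_of_polynomials p q s hq hs
    (fun u hu i => (h₁ u (hsU _ hu) i).eval_eq_mul (hq0 i) (hpq i))
    (fun u hu i => (h₂ u (hsU _ hu) i).eval_eq_mul (hq0 i) (hpq i))
  refine ⟨α ^ (-(N : ℤ)), zpow_pos (by linarith) _, fun a ha => ?_⟩
  choose r hr using fun i => exists_eq_pow_mul_of_adicNorm_le hα hyp.irreducible_R₀ N
    ((adicNorm_le_adicVecNorm α a i).trans ha)
  obtain ⟨v, w, hv, hw, hsvw, hvw⟩ := hN r
  refine ⟨v, w, hv, hw, hsU _ hsvw, fun i => ⟨p i, q i, (hvw i).1, hpq i, ?_⟩⟩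
  rw [(hvw i).2, mul_div_cancel_right₀ _ (hvw i).1, hr i, map_mul, map_pow]

/-- A rational function `p / q` that vanishes at `c` takes values divisible by a given power of the
uniformizer at all points close to `c`. -/
theorem exists_eval_eq_pow_mul_of_close {τ : Type*} {ϖ : R₀} (hϖ : Irreducible ϖ)
    (c : τ → F₀) (p q : MvPolynomial τ F₀) (hp : MvPolynomial.eval c p = 0)
    (hq : MvPolynomial.eval c q ≠ 0) (N : ℕ) :
    ∃ M₀ : ℕ, ∀ M ≥ M₀, ∀ x : τ → R₀, ∃ r : R₀,
      MvPolynomial.eval (fun i => c i + algebraMap R₀ F₀ (ϖ ^ M * x i)) q ≠ 0 ∧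
      MvPolynomial.eval (fun i => c i + algebraMap R₀ F₀ (ϖ ^ M * x i)) p =
        algebraMap R₀ F₀ (ϖ ^ N * r) *
          MvPolynomial.eval (fun i => c i + algebraMap R₀ F₀ (ϖ ^ M * x i)) q := by
  have hπ : algebraMap R₀ F₀ ϖ ≠ 0 := by simpa using hϖ.ne_zero
  let sh : MvPolynomial τ F₀ → MvPolynomial τ F₀ :=
    MvPolynomial.bind₁ fun i => MvPolynomial.C (c i) + MvPolynomial.X i
  have hsh : ∀ Q x, MvPolynomial.eval x (sh Q) = MvPolynomial.eval (fun i => c i + x i) Q :=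
    fun Q x => by simp [sh, MvPolynomial.eval_bind₁]
  have hcoeff : ∀ Q, (sh Q).coeff 0 = MvPolynomial.eval c Q := fun Q => by
    rw [← MvPolynomial.constantCoeff_eq, ← MvPolynomial.eval_zero, hsh]
    simp
  obtain ⟨M₁, h₁⟩ := exists_integral_rescaling hϖ 0
    (MvPolynomial.C (MvPolynomial.eval c q * algebraMap R₀ F₀ ϖ ^ N)⁻¹ * sh p) (fun m hm => by
      rcases Nat.eq_zero_or_pos m.degree with h | h
      · have : m = 0 := (Finsupp.degree_eq_zero_iff m).1 h
        subst this
        exact absurd (by rw [MvPolynomial.coeff_C_mul, hcoeff, hp, mul_zero]) hm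
      · omega)
  obtain ⟨M₂, h₂⟩ := exists_unit_rescaling hϖ (sh q) (by rwa [hcoeff])
  refine ⟨max M₁ M₂, fun M hM x => ?_⟩
  obtain ⟨P', hP'⟩ := h₁ M ((le_max_left _ _).trans hM)
  obtain ⟨Q', hQ'⟩ := h₂ M ((le_max_right _ _).trans hM)
  obtain ⟨u, hu⟩ := isUnit_one_add_mul hϖ (MvPolynomial.eval x Q')
  have hPx := hP' x
  have hQx := hQ' x
  rw [hsh, hcoeff, ← hu] at hQx
  rw [map_mul, hsh, MvPolynomial.eval_C, inv_mul_eq_iff_eq_mul₀ (mul_ne_zero hq (pow_ne_zero _ hπ))]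
    at hPx
  refine ⟨ϖ * MvPolynomial.eval x P' * (u⁻¹ : R₀ˣ), ?_, ?_⟩
  · rw [hQx]
    exact mul_ne_zero hq (u.isUnit.map _).ne_zero
  · have hu1 : algebraMap R₀ F₀ (u⁻¹ : R₀ˣ) * algebraMap R₀ F₀ u = 1 := by
      rw [← map_mul, Units.inv_mul, map_one]
    rw [hQx, hPx]
    simp only [map_mul, map_pow, zero_mul, zero_add, pow_one]
    linear_combination (-(MvPolynomial.eval c q * algebraMap R₀ F₀ ϖ ^ N * algebraMap R₀ F₀ ϖ *
      algebraMap R₀ F₀ (MvPolynomial.eval x P'))) * hu1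

end SmallVectors

noncomputable section RationalChart

open MvPolynomial

/-- A birational chart of the affine variety with coordinate ring `A`: the coordinate ring embeds
into the ring of regular functions on the basic open set of affine space defined by `q`, and the
coordinates of affine space are the fractions `num i / den` of elements of `A`. -/
structure RationalChart (k A σ : Type*) [Field k] [CommRing A] [Algebra k A] where
  q : MvPolynomial σ k
  q_ne_zero : q ≠ 0
  toAway : A →ₐ[k] Localization.Away q
  toAway_injective : Function.Injective toAway
  num : σ → A
  den : A
  den_ne_zero : den ≠ 0
  toAway_num : ∀ i, toAway (num i) = algebraMap (MvPolynomial σ k) _ (X i) * toAway den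

theorem IsRationalVariety.exists_rationalChart {k A : Type*} [Field k] [CommRing A] [Algebra k A]
    [Algebra.FiniteType k A] (h : IsRationalVariety k A) :
    ∃ n : ℕ, Nonempty (RationalChart k A (Fin n)) := by
  obtain ⟨hA, n, ⟨e⟩⟩ := h
  refine ⟨n, ?_⟩
  let K := FractionRing (MvPolynomial (Fin n) k)
  let ι : A →ₐ[k] K := e.toAlgHom.comp (IsScalarTower.toAlgHom k A (FractionRing A))
  have hι : Function.Injective ι := e.injective.comp (IsFractionRing.injective A _)
  obtain ⟨S, hS⟩ := Algebra.FiniteType.out (R := k) (A := A)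
  classical
  obtain ⟨b, hb⟩ := IsLocalization.exist_integer_multiples_of_finset
    (nonZeroDivisors (MvPolynomial (Fin n) k)) (S.image ι)
  let q : MvPolynomial (Fin n) k := b
  have hq : q ≠ 0 := nonZeroDivisors.ne_zero b.2
  have injK := IsFractionRing.injective (MvPolynomial (Fin n) k) K
  have hqK : IsUnit (IsScalarTower.toAlgHom k (MvPolynomial (Fin n) k) K q) :=
    ((map_ne_zero_iff _ injK).2 hq).isUnit
  let j : Localization.Away q →ₐ[k] K :=
    IsLocalization.Away.liftAlgHom q (f := IsScalarTower.toAlgHom k (MvPolynomial (Fin n) k) K) hqK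
  have hj : ∀ p, j (algebraMap _ _ p) = algebraMap (MvPolynomial (Fin n) k) K p := fun p =>
    IsLocalization.Away.lift_eq q hqK p
  have hjinj : Function.Injective j := by
    rw [injective_iff_map_eq_zero]
    intro r hr
    obtain ⟨m, p, hp⟩ := IsLocalization.Away.surj q r
    have h1 := congrArg j hp
    rw [map_mul, hr, zero_mul, hj] at h1
    have h2 : p = 0 := injK (by rw [← h1, map_zero])
    rw [h2, map_zero] at hp
    exact ((IsLocalization.Away.algebraMap_isUnit q).pow m).mul_left_eq_zero.1 hp
  have hrange : ∀ a, ι a ∈ j.range := by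
    intro a
    have ha : a ∈ Algebra.adjoin k (S : Set A) := hS ▸ Algebra.mem_top
    suffices Algebra.adjoin k (S : Set A) ≤ j.range.comap ι from this ha
    refine Algebra.adjoin_le fun x hx => ?_
    obtain ⟨p, hp⟩ := hb (ι x) (Finset.mem_image_of_mem _ hx)
    refine ⟨algebraMap _ _ p * IsLocalization.Away.invSelf q, ?_⟩
    have h1 := congrArg j (IsLocalization.Away.mul_invSelf (S := Localization.Away q) q)
    rw [map_mul, hj, map_one] at h1
    change j _ = ι x
    rw [map_mul, hj, hp, Algebra.smul_def, mul_right_comm, h1, one_mul]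
  let φ : A →ₐ[k] Localization.Away q :=
    (AlgEquiv.ofInjective j hjinj).symm.toAlgHom.comp (ι.codRestrict j.range hrange)
  have hφ : ∀ a, j (φ a) = ι a := fun a =>
    congrArg Subtype.val ((AlgEquiv.ofInjective j hjinj).apply_symm_apply ⟨ι a, hrange a⟩)
  obtain ⟨c, hc⟩ := IsLocalization.exist_integer_multiples_of_finite (nonZeroDivisors A)
    (fun i : Fin n => e.symm (algebraMap (MvPolynomial (Fin n) k) K (X i)))
  choose a ha using hc
  refine ⟨⟨q, hq, φ, fun x y hxy => hι (by rw [← hφ, hxy, hφ]), a, c, nonZeroDivisors.ne_zero c.2,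
    fun i => hjinj ?_⟩⟩
  rw [map_mul, hφ, hφ, hj]
  change e (algebraMap A _ (a i)) = _ * e (algebraMap A _ (c : A))
  rw [ha, Algebra.smul_def, map_mul, e.apply_symm_apply, mul_comm]

namespace RationalChart

variable {k A σ : Type*} [Field k] [CommRing A] [Algebra k A] (C : RationalChart k A σ)

/-- The point of the variety with given coordinates in the chart. -/
def point {E : Type*} [CommRing E] [Algebra k E] (x : σ → E) (hx : IsUnit (aeval x C.q)) :
    A →ₐ[k] E :=
  (IsLocalization.Away.liftAlgHom (S := Localization.Away C.q) C.q (f := aeval x) hx).comp C.toAway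

theorem exists_polynomial (a : A) : ∃ (m : ℕ) (p : MvPolynomial σ k),
    C.toAway a * algebraMap (MvPolynomial σ k) _ C.q ^ m = algebraMap _ _ p := by
  obtain ⟨m, p, hp⟩ := IsLocalization.Away.surj C.q (C.toAway a)
  exact ⟨m, p, by rw [← hp]⟩

section

variable {E : Type*} [CommRing E] [Algebra k E] (x : σ → E) (hx : IsUnit (aeval x C.q))

theorem point_mul_pow {a : A} {m : ℕ} {p : MvPolynomial σ k}
    (h : C.toAway a * algebraMap (MvPolynomial σ k) _ C.q ^ m = algebraMap _ _ p) :
    C.point x hx a * aeval x C.q ^ m = aeval x p := by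
  have := congrArg
    (IsLocalization.Away.liftAlgHom (S := Localization.Away C.q) C.q (f := aeval x) hx) h
  simpa [point] using this

theorem point_num (i : σ) : C.point x hx (C.num i) = x i * C.point x hx C.den := by
  simp [point, C.toAway_num]

end

theorem comp_point {E E₂ : Type*} [CommRing E] [Algebra k E] [CommRing E₂] [Algebra k E₂]
    (φ : E →ₐ[k] E₂) (x : σ → E) (hx : IsUnit (aeval x C.q))
    (x' : σ → E₂) (hx' : IsUnit (aeval x' C.q)) (h : ∀ i, φ (x i) = x' i) :
    φ.comp (C.point x hx) = C.point x' hx' := by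
  obtain rfl : (fun i => φ (x i)) = x' := funext h
  ext a
  obtain ⟨m, p, hp⟩ := C.exists_polynomial a
  have h1 := congrArg φ (C.point_mul_pow x hx hp)
  rw [map_mul, map_pow, MvPolynomial.comp_aeval_apply, MvPolynomial.comp_aeval_apply,
    ← C.point_mul_pow _ hx' hp] at h1
  exact (hx'.pow m).mul_left_inj.1 h1

/-- A nonzero function does not vanish at some rational point of the chart. -/
theorem exists_point_ne_zero [Infinite k] {a : A} (ha : a ≠ 0) :
    ∃ (x : σ → k) (hx : IsUnit (aeval x C.q)), C.point x hx a ≠ 0 := by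
  obtain ⟨m, p, hp⟩ := C.exists_polynomial a
  have hp0 : p ≠ 0 := by
    rintro rfl
    rw [map_zero] at hp
    have := ((IsLocalization.Away.algebraMap_isUnit (S := Localization.Away C.q)
      C.q).pow m).mul_left_eq_zero.1 hp
    exact ha (C.toAway_injective (by rw [this, map_zero]))
  obtain ⟨x, hx⟩ := MvPolynomial.exists_eval_ne_zero (mul_ne_zero C.q_ne_zero hp0)
  rw [map_mul] at hx
  have hxq : IsUnit (aeval x C.q) := by
    rw [MvPolynomial.aeval_eq_eval]
    exact (left_ne_zero_of_mul hx).isUnit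
  refine ⟨x, hxq, fun h => right_ne_zero_of_mul hx ?_⟩
  have := C.point_mul_pow x hxq hp
  rw [h, zero_mul, MvPolynomial.aeval_eq_eval] at this
  exact this.symm

variable {E : Type*} [Field E] [Algebra k E]

/-- Up to a power of the denominator, a polynomial in the chart coordinates is a regular
function. -/
theorem exists_den_pow_mul (p : MvPolynomial σ k) : ∃ (m : ℕ) (a : A),
    C.toAway a = C.toAway C.den ^ m * algebraMap _ _ p ∧
    ∀ (g : A →ₐ[k] E) (x : σ → E), (∀ i, g (C.num i) = x i * g C.den) →
      g a = g C.den ^ m * aeval x p := by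
  induction p using MvPolynomial.induction_on with
  | C r =>
    refine ⟨0, algebraMap k A r, ?_, fun g x _ => by simp⟩
    rw [AlgHom.commutes, pow_zero, one_mul]
    rfl
  | add p₁ p₂ h₁ h₂ =>
    obtain ⟨m₁, a₁, h₁, h₁'⟩ := h₁
    obtain ⟨m₂, a₂, h₂, h₂'⟩ := h₂
    refine ⟨m₁ + m₂, a₁ * C.den ^ m₂ + a₂ * C.den ^ m₁, ?_, fun g x hg => ?_⟩
    · simp only [map_add, map_mul, map_pow, h₁, h₂]
      ring
    · simp only [map_add, map_mul, map_pow, h₁' g x hg, h₂' g x hg]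
      ring
  | mul_X p i h =>
    obtain ⟨m, a, h, h'⟩ := h
    refine ⟨m + 1, a * C.num i, ?_, fun g x hg => ?_⟩
    · simp only [map_mul, h, C.toAway_num]
      ring
    · simp only [map_mul, h' g x hg, hg, aeval_X]
      ring

/-- A point at which the denominator does not vanish and whose coordinates lie in the chart is
determined by its coordinates. -/
theorem eq_point (g : A →ₐ[k] E) (x : σ → E) (hg : ∀ i, g (C.num i) = x i * g C.den)
    (hden : g C.den ≠ 0) (hx : IsUnit (aeval x C.q)) : g = C.point x hx := by
  ext a
  obtain ⟨m, p, hp⟩ := C.exists_polynomial a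
  obtain ⟨m₁, a₁, h₁, h₁'⟩ := C.exists_den_pow_mul (E := E) p
  obtain ⟨m₂, a₂, h₂, h₂'⟩ := C.exists_den_pow_mul (E := E) (C.q ^ m)
  have key : a * a₂ * C.den ^ m₁ = a₁ * C.den ^ m₂ := by
    apply C.toAway_injective
    simp only [map_mul, map_pow, h₁, h₂, ← hp]
    ring
  have := congrArg g key
  simp only [map_mul, map_pow, h₁' g x hg, h₂' g x hg] at this
  have h3 : g a * aeval x C.q ^ m = aeval x p := by
    apply mul_left_cancel₀ (pow_ne_zero (m₁ + m₂) hden)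
    linear_combination this
  exact mul_right_cancel₀ (pow_ne_zero m hx.ne_zero) (h3.trans (C.point_mul_pow x hx hp).symm)

/-- There is a nonzero function such that each point at which it does not vanish is given by its
chart coordinates. -/
theorem exists_ne_zero_forall_eq_point : ∃ d : A, d ≠ 0 ∧ ∀ g : A →ₐ[k] E, g d ≠ 0 →
    ∃ (x : σ → E) (hx : IsUnit (aeval x C.q)), g = C.point x hx := by
  obtain ⟨m, a, ha, ha'⟩ := C.exists_den_pow_mul (E := E) C.q
  have : IsDomain (Localization.Away C.q) :=
    IsLocalization.isDomain_localization (powers_le_nonZeroDivisors_of_noZeroDivisors C.q_ne_zero)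
  have : IsDomain A := C.toAway_injective.isDomain C.toAway
  have hden : C.toAway C.den ≠ 0 := (map_ne_zero_iff _ C.toAway_injective).2 C.den_ne_zero
  refine ⟨C.den * a, mul_ne_zero C.den_ne_zero fun h => ?_, fun g hg => ?_⟩
  · rw [h, map_zero] at ha
    exact mul_ne_zero (pow_ne_zero _ hden)
      (IsLocalization.Away.algebraMap_isUnit C.q).ne_zero ha.symm
  · rw [map_mul] at hg
    have hgd := left_ne_zero_of_mul hg
    have hx : ∀ i, g (C.num i) = g (C.num i) / g C.den * g C.den := fun i => by field_simp
    have h1 := ha' g (fun i => g (C.num i) / g C.den) hx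
    have h2 : IsUnit (aeval (fun i => g (C.num i) / g C.den) C.q) :=
      (right_ne_zero_of_mul (h1 ▸ right_ne_zero_of_mul hg)).isUnit
    exact ⟨_, h2, C.eq_point g _ hx hgd h2⟩

end RationalChart

end RationalChart

noncomputable section ConvolutionPoints

open WithConv MvPolynomial TensorProduct

variable {k A : Type*} [Field k] [CommRing A] [HopfAlgebra k A]

section

variable {E E₂ : Type*} [CommRing E] [Algebra k E] [CommRing E₂] [Algebra k E₂]

/-- The map on points of an affine group scheme induced by a homomorphism of algebras. -/
def convMap (φ : E →ₐ[k] E₂) (g : WithConv (A →ₐ[k] E)) : WithConv (A →ₐ[k] E₂) :=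
  toConv (φ.comp g.ofConv)

/-- The inverse of a point of an affine group scheme. -/
def convInverse (g : WithConv (A →ₐ[k] E)) : WithConv (A →ₐ[k] E) :=
  toConv (g.ofConv.comp (HopfAlgebra.antipodeAlgHom k A))

theorem convMap_mul (φ : E →ₐ[k] E₂) (g h : WithConv (A →ₐ[k] E)) :
    convMap φ (g * h) = convMap φ g * convMap φ h :=
  WithConv.ext (AlgHom.comp_convMul_distrib φ g h)

theorem convMap_one (φ : E →ₐ[k] E₂) : convMap φ (1 : WithConv (A →ₐ[k] E)) = 1 := by
  refine WithConv.ext (AlgHom.ext fun a => ?_)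
  change φ (algebraMap k E (Coalgebra.counit a)) = algebraMap k E₂ (Coalgebra.counit a)
  exact φ.commutes _

theorem convInverse_mul (g : WithConv (A →ₐ[k] E)) : convInverse g * g = 1 := by
  have h := congrArg (convMap g.ofConv) (AlgHom.antipode_id_cancel (R := k) (A := A))
  rwa [convMap_mul, convMap_one] at h

theorem mul_convInverse (g : WithConv (A →ₐ[k] E)) : g * convInverse g = 1 := by
  have h1 : toConv (AlgHom.id k A) * toConv (HopfAlgebra.antipodeAlgHom k A) = 1 := by
    apply WithConv.ofConv_injective
    apply AlgHom.toLinearMap_injective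
    apply WithConv.toConv_injective
    rw [AlgHom.toLinearMap_convMul, AlgHom.toLinearMap_convOne]
    exact LinearMap.id_mul_antipode
  have h := congrArg (convMap g.ofConv) h1
  rwa [convMap_mul, convMap_one] at h

theorem convInverse_mul_cancel_left (g h : WithConv (A →ₐ[k] E)) :
    convInverse g * (g * h) = h := by
  rw [← mul_assoc, convInverse_mul, one_mul]

theorem mul_convInverse_cancel_left (g h : WithConv (A →ₐ[k] E)) :
    g * (convInverse g * h) = h := by
  rw [← mul_assoc, mul_convInverse, one_mul]

/-- The translate of a nonzero function by the generic point is nonzero. -/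
theorem translate_ne_zero [Nontrivial E] (γ : WithConv (A →ₐ[k] E)) {d : A} (hd : d ≠ 0) :
    (convMap (Algebra.TensorProduct.includeRight : E →ₐ[k] A ⊗[k] E) γ *
      toConv (Algebra.TensorProduct.includeLeft : A →ₐ[k] A ⊗[k] E)).ofConv d ≠ 0 := by
  let i₁ : E →ₐ[k] A ⊗[k] E := Algebra.TensorProduct.includeRight
  let i₂ : A →ₐ[k] A ⊗[k] E := Algebra.TensorProduct.includeLeft
  let ψ : A →ₐ[k] A ⊗[k] E := (convMap i₁ (convInverse γ) * toConv i₂).ofConv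
  let L : A ⊗[k] E →ₐ[k] A ⊗[k] E := Algebra.TensorProduct.lift ψ i₁ fun _ _ => Commute.all _ _
  have hL₁ : L.comp i₁ = i₁ := Algebra.TensorProduct.lift_comp_includeRight ψ i₁
    fun _ _ => Commute.all _ _
  have hL₂ : L.comp i₂ = ψ := by
    ext a
    simp [L, i₂]
  have hL : convMap L (convMap i₁ γ * toConv i₂) = toConv i₂ := by
    rw [convMap_mul]
    have e₁ : convMap L (convMap i₁ γ) = convMap i₁ γ := by
      change toConv ((L.comp i₁).comp γ.ofConv) = _
      rw [hL₁]
      rfl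
    have e₂ : convMap L (toConv i₂) = convInverse (convMap i₁ γ) * toConv i₂ := by
      change toConv (L.comp i₂) = _
      rw [hL₂]
      rfl
    rw [e₁, e₂, mul_convInverse_cancel_left]
  intro h0
  have h1 : i₂ d = L ((convMap i₁ γ * toConv i₂).ofConv d) :=
    (congrArg (fun f => f.ofConv d) hL).symm
  rw [h0, map_zero] at h1
  exact hd (Algebra.TensorProduct.includeLeft_injective (S := k)
    (FaithfulSMul.algebraMap_injective k E) (by rw [map_zero]; exact h1))

end

namespace RationalChart

variable {σ : Type*} (C : RationalChart k A σ) {E : Type*} [Field E] [Algebra k E]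

/-- A nonzero function does not vanish at some rational point of any translate of the chart. -/
theorem exists_translate_ne_zero [Infinite k] (γ : WithConv (A →ₐ[k] E)) {d : A} (hd : d ≠ 0) :
    ∃ (x : σ → k) (hx : IsUnit (aeval x C.q)),
      (γ * convMap (Algebra.ofId k E) (toConv (C.point x hx))).ofConv d ≠ 0 := by
  let e := Module.Basis.ofVectorSpace k E
  let b : A ⊗[k] E := (convMap (Algebra.TensorProduct.includeRight : E →ₐ[k] A ⊗[k] E) γ *
      toConv (Algebra.TensorProduct.includeLeft : A →ₐ[k] A ⊗[k] E)).ofConv d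
  have hb : b ≠ 0 := translate_ne_zero γ hd
  obtain ⟨i, hi⟩ : ∃ i, (e.baseChange A).repr b i ≠ 0 := by
    by_contra! h
    exact hb ((e.baseChange A).repr.map_eq_zero_iff.1 (Finsupp.ext h))
  obtain ⟨x, hx, hne⟩ := C.exists_point_ne_zero hi
  refine ⟨x, hx, fun h0 => hne ?_⟩
  let sp : A ⊗[k] E →ₐ[k] E := Algebra.TensorProduct.lift
    ((Algebra.ofId k E).comp (C.point x hx)) (AlgHom.id k E) fun _ _ => Commute.all _ _
  have hsp : sp b = (γ * convMap (Algebra.ofId k E) (toConv (C.point x hx))).ofConv d := by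
    have : convMap sp (convMap (Algebra.TensorProduct.includeRight : E →ₐ[k] A ⊗[k] E) γ *
        toConv (Algebra.TensorProduct.includeLeft : A →ₐ[k] A ⊗[k] E)) =
        γ * convMap (Algebra.ofId k E) (toConv (C.point x hx)) := by
      rw [convMap_mul]
      congr 1
      · exact WithConv.ext (AlgHom.ext fun a => by simp [convMap, sp])
      · exact WithConv.ext (AlgHom.ext fun a => by simp [convMap, sp])
    rw [← this]
    rfl
  have hrepr : ∀ y : A ⊗[k] E,
      e.repr (sp y) i = C.point x hx ((e.baseChange A).repr y i) := by
    intro y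
    induction y with
    | zero => simp
    | add y z hy hz => simp [hy, hz]
    | tmul a y =>
      simp only [sp, Algebra.TensorProduct.lift_tmul, AlgHom.comp_apply, Algebra.ofId_apply,
        AlgHom.id_apply, Module.Basis.baseChange_repr_tmul, map_smul, ← Algebra.smul_def,
        Finsupp.smul_apply, smul_eq_mul]
      rw [mul_comm]
  rw [← hrepr, hsp, h0]
  simp

theorem exists_polynomial_of_isLocalization {τ : Type*} (X₁ X₂ : σ → MvPolynomial τ E)
    (γ : WithConv (A →ₐ[k] E)) (a : A) (s : MvPolynomial τ E)
    (hs : s = aeval X₁ C.q * aeval X₂ C.q) (R : Type*) [CommRing R] [Algebra (MvPolynomial τ E) R]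
    [IsLocalization.Away s R] [Algebra k R] [IsScalarTower k (MvPolynomial τ E) R] :
    ∃ (m : ℕ) (P : MvPolynomial τ E), ∀ (c : τ → E) (x₁ x₂ : σ → E)
      (hx₁ : IsUnit (aeval x₁ C.q)) (hx₂ : IsUnit (aeval x₂ C.q)),
      (∀ i, eval c (X₁ i) = x₁ i) → (∀ i, eval c (X₂ i) = x₂ i) →
      (toConv (C.point x₁ hx₁) * γ * toConv (C.point x₂ hx₂)).ofConv a * eval c s ^ m =
        eval c P := by
  let alg : MvPolynomial τ E →ₐ[k] R := IsScalarTower.toAlgHom k _ _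
  have hunit : IsUnit (alg s) := IsLocalization.Away.algebraMap_isUnit s
  have hunit' : IsUnit (alg (aeval X₁ C.q)) ∧ IsUnit (alg (aeval X₂ C.q)) := by
    rw [hs, map_mul] at hunit
    exact IsUnit.mul_iff.1 hunit
  have hu₁ : IsUnit (aeval (fun i => alg (X₁ i)) C.q) := by
    rw [← MvPolynomial.comp_aeval_apply]
    exact hunit'.1
  have hu₂ : IsUnit (aeval (fun i => alg (X₂ i)) C.q) := by
    rw [← MvPolynomial.comp_aeval_apply]
    exact hunit'.2
  let const : E →ₐ[k] R := alg.comp (IsScalarTower.toAlgHom k E _)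
  let Γ : WithConv (A →ₐ[k] R) :=
    toConv (C.point _ hu₁) * convMap const γ * toConv (C.point _ hu₂)
  obtain ⟨m, P, hP⟩ := IsLocalization.Away.surj s (Γ.ofConv a)
  refine ⟨m, P, fun c x₁ x₂ hx₁ hx₂ h₁ h₂ => ?_⟩
  let evc : MvPolynomial τ E →ₐ[k] E := (aeval c : MvPolynomial τ E →ₐ[E] E).restrictScalars k
  have hevc : ∀ p, evc p = eval c p := fun p => by
    change aeval c p = _
    rw [MvPolynomial.aeval_eq_eval]
  have hsc : IsUnit (evc s) := by
    rw [hs, map_mul, MvPolynomial.comp_aeval_apply, MvPolynomial.comp_aeval_apply]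
    simp only [hevc, h₁, h₂]
    exact hx₁.mul hx₂
  obtain ⟨ev, hev⟩ : ∃ ev : R →ₐ[k] E, ∀ p, ev (alg p) = eval c p :=
    ⟨IsLocalization.Away.liftAlgHom s (f := evc) hsc, fun p =>
      (IsLocalization.Away.lift_eq s hsc p).trans (hevc p)⟩
  have hΓ : convMap ev Γ = toConv (C.point x₁ hx₁) * γ * toConv (C.point x₂ hx₂) := by
    rw [convMap_mul, convMap_mul]
    congr 1
    · congr 1
      · exact WithConv.ext (C.comp_point ev _ _ _ _ fun i => by rw [hev, h₁])
      · refine WithConv.ext (AlgHom.ext fun a => ?_)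
        change ev (alg (algebraMap E _ (γ.ofConv a))) = _
        rw [hev, MvPolynomial.algebraMap_eq, eval_C]
    · exact WithConv.ext (C.comp_point ev _ _ _ _ fun i => by rw [hev, h₂])
  have h := congrArg ev hP
  rw [map_mul, map_pow] at h
  change ev _ * ev (alg s) ^ m = ev (alg P) at h
  rw [hev, hev] at h
  rw [← hΓ]
  exact h

/-- The functions on a product of two families of chart points with a fixed point in between are
rational functions of the parameters. -/
theorem exists_polynomial_mul_mul {τ : Type*} (X₁ X₂ : σ → MvPolynomial τ E)
    (γ : WithConv (A →ₐ[k] E)) (a : A) :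
    ∃ (m : ℕ) (P : MvPolynomial τ E), ∀ (c : τ → E) (x₁ x₂ : σ → E)
      (hx₁ : IsUnit (aeval x₁ C.q)) (hx₂ : IsUnit (aeval x₂ C.q)),
      (∀ i, eval c (X₁ i) = x₁ i) → (∀ i, eval c (X₂ i) = x₂ i) →
      (toConv (C.point x₁ hx₁) * γ * toConv (C.point x₂ hx₂)).ofConv a *
        eval c (aeval X₁ C.q * aeval X₂ C.q) ^ m = eval c P :=
  C.exists_polynomial_of_isLocalization X₁ X₂ γ a _ rfl
    (Localization.Away (aeval X₁ C.q * aeval X₂ C.q))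

end RationalChart

section DefinedOver

variable {E : Type*} [Field E] [Algebra k E]

/-- The point `g` is defined over the intermediate field `K`. -/
def IsDefinedOver (K : IntermediateField k E) (g : GroupPoints k A E) : Prop :=
  ∃ g' : GroupPoints k A K, GroupPoints.map K.val g' = g

variable {K : IntermediateField k E}

theorem IsDefinedOver.mul {g h : GroupPoints k A E} (hg : IsDefinedOver K g)
    (hh : IsDefinedOver K h) : IsDefinedOver K (g * h) := by
  obtain ⟨g', rfl⟩ := hg
  obtain ⟨h', rfl⟩ := hh
  exact ⟨g' * h', convMap_mul _ _ _⟩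

theorem IsDefinedOver.convInverse {g : GroupPoints k A E} (hg : IsDefinedOver K g) :
    IsDefinedOver K (convInverse g) := by
  obtain ⟨g', rfl⟩ := hg
  exact ⟨_root_.convInverse g', rfl⟩

theorem RationalChart.isDefinedOver_point {σ : Type*} (C : RationalChart k A σ) (x : σ → E)
    (hx : IsUnit (aeval x C.q)) (hxK : ∀ i, x i ∈ K) :
    IsDefinedOver K (toConv (C.point x hx)) := by
  have hx' : IsUnit (aeval (fun i => (⟨x i, hxK i⟩ : K)) C.q) := by
    refine Ne.isUnit fun h => hx.ne_zero ?_
    have h1 := congrArg K.val h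
    rwa [MvPolynomial.comp_aeval_apply, map_zero] at h1
  exact ⟨toConv (C.point _ hx'), WithConv.ext (C.comp_point K.val _ _ _ _ fun _ => rfl)⟩

end DefinedOver

end ConvolutionPoints

noncomputable section Factorization

open WithConv MvPolynomial

namespace RationalChart

variable {k A σ : Type*} [Field k] [CommRing A] [HopfAlgebra k A] (C : RationalChart k A σ)

/-- The chart coordinates, relative to an origin `b`, of a product of two families of chart points
with a fixed point in between are rational functions `p i / q i` of the parameters. -/
theorem exists_coordinate_polynomials {E : Type*} [Field E] [Algebra k E] {τ : Type*}
    (X₁ X₂ : σ → MvPolynomial τ E) (γ : WithConv (A →ₐ[k] E)) (b : σ → E) :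
    ∃ (p q : σ → MvPolynomial τ E) (s : MvPolynomial τ E), ∀ (c : τ → E) (x₁ x₂ : σ → E),
      (∀ i, eval c (X₁ i) = x₁ i) → (∀ i, eval c (X₂ i) = x₂ i) →
      (eval c s ≠ 0 → IsUnit (aeval x₁ C.q) ∧ IsUnit (aeval x₂ C.q)) ∧
      ∀ (hx₁ : IsUnit (aeval x₁ C.q)) (hx₂ : IsUnit (aeval x₂ C.q)) (f : A →ₐ[k] E),
        toConv f = toConv (C.point x₁ hx₁) * γ * toConv (C.point x₂ hx₂) →
        (eval c s ≠ 0 ↔ f C.den ≠ 0) ∧ ∀ i, (f C.den ≠ 0 → eval c (q i) ≠ 0) ∧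
          ∀ y, eval c (p i) = y * eval c (q i) ↔ f (C.num i) = (b i + y) * f C.den := by
  choose m P hP using fun i => C.exists_polynomial_mul_mul X₁ X₂ γ (C.num i)
  obtain ⟨l, D, hD⟩ := C.exists_polynomial_mul_mul X₁ X₂ γ C.den
  let s : MvPolynomial τ E := aeval X₁ C.q * aeval X₂ C.q
  refine ⟨fun i => P i * s ^ l - MvPolynomial.C (b i) * D * s ^ m i, fun i => D * s ^ m i, s * D,
    fun c x₁ x₂ h₁ h₂ => ?_⟩
  let evc : MvPolynomial τ E →ₐ[k] E := (aeval c : MvPolynomial τ E →ₐ[E] E).restrictScalars k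
  have hevc : ∀ p, evc p = eval c p := fun p => by
    change aeval c p = _
    rw [MvPolynomial.aeval_eq_eval]
  have hs : eval c s = aeval x₁ C.q * aeval x₂ C.q := by
    rw [← hevc, map_mul, MvPolynomial.comp_aeval_apply, MvPolynomial.comp_aeval_apply]
    simp only [hevc, h₁, h₂]
  refine ⟨fun h => ?_, fun hx₁ hx₂ f hf => ?_⟩
  · rw [map_mul, hs] at h
    have h' := left_ne_zero_of_mul h
    exact ⟨(left_ne_zero_of_mul h').isUnit, (right_ne_zero_of_mul h').isUnit⟩
  · have hs0 : eval c s ≠ 0 := by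
      rw [hs]
      exact mul_ne_zero hx₁.ne_zero hx₂.ne_zero
    have hPc : ∀ i, f (C.num i) * eval c s ^ m i = eval c (P i) := fun i => by
      have := hP i c x₁ x₂ hx₁ hx₂ h₁ h₂
      rwa [← hf] at this
    have hDc : f C.den * eval c s ^ l = eval c D := by
      have := hD c x₁ x₂ hx₁ hx₂ h₁ h₂
      rwa [← hf] at this
    refine ⟨?_, fun i => ⟨fun h => ?_, fun y => ?_⟩⟩
    · rw [map_mul, ← hDc]
      simp [hs0]
    · rw [map_mul, map_pow, ← hDc]
      exact mul_ne_zero (mul_ne_zero h (pow_ne_zero _ hs0)) (pow_ne_zero _ hs0)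
    · simp only [map_sub, map_mul, map_pow, eval_C, ← hPc, ← hDc]
      refine ⟨fun h => mul_right_cancel₀ (pow_ne_zero (l + m i) hs0) ?_, fun h => ?_⟩
      · rw [pow_add]
        linear_combination h
      · linear_combination eval c s ^ l * eval c s ^ m i * h

variable {R₀ F₀ : Type*} [CommRing R₀] [IsDomain R₀] [IsDiscreteValuationRing R₀]
  [Field F₀] [Algebra R₀ F₀] [IsFractionRing R₀ F₀] [Algebra k F₀] [Finite σ]

/-- The points close to a given point `P` of the chart are products `P₁ * P⁻¹ * P₂` of points whose
coordinates differ from those of `P` by elements of `V` and of `W`. -/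
theorem exists_point_mul_point {T : Subring R₀} {t : T} {F₁ F₂ : Subfield F₀}
    {V W : Submodule T R₀} (hyp : AdditiveDecomposition T t F₁ F₂ V W)
    (x₀ : σ → F₀) (hx₀ : IsUnit (aeval x₀ C.q)) (hden : C.point x₀ hx₀ C.den ≠ 0) :
    ∃ N : ℕ, ∀ (a : σ → R₀) (f : A →ₐ[k] F₀), f C.den ≠ 0 →
      (∀ i, f (C.num i) = (x₀ i + algebraMap R₀ F₀ (t ^ N * a i)) * f C.den) →
      ∃ (v w : σ → R₀) (hv : IsUnit (aeval (fun i => x₀ i + algebraMap R₀ F₀ (v i)) C.q))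
        (hw : IsUnit (aeval (fun i => x₀ i + algebraMap R₀ F₀ (w i)) C.q)),
        (∀ i, v i ∈ V) ∧ (∀ i, w i ∈ W) ∧
        toConv f = toConv (C.point _ hv) * convInverse (toConv (C.point x₀ hx₀)) *
          toConv (C.point _ hw) := by
  obtain ⟨p, q, s, h⟩ := C.exists_coordinate_polynomials
    (fun i => MvPolynomial.C (x₀ i) + X (Sum.inl i))
    (fun i => MvPolynomial.C (x₀ i) + X (Sum.inr i))
    (convInverse (toConv (C.point x₀ hx₀))) x₀
  have hleft : ∀ f, toConv f = toConv f * convInverse (toConv (C.point x₀ hx₀)) *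
      toConv (C.point x₀ hx₀) := fun f => by
    rw [mul_assoc, convInverse_mul, mul_one]
  have hright : ∀ f, toConv f = toConv (C.point x₀ hx₀) *
      convInverse (toConv (C.point x₀ hx₀)) * toConv f := fun f => by
    rw [mul_convInverse, one_mul]
  have h0 := (h 0 x₀ x₀ (by simp) (by simp)).2 hx₀ hx₀ _ (hleft _)
  obtain ⟨N₁, hN₁⟩ := hyp.exists_of_polynomials p q s (fun i => (h0.2 i).1 hden) (h0.1.2 hden)
    (fun u hu i => by
      obtain ⟨hunits, h'⟩ := h (Sum.elim u 0) (fun i => x₀ i + u i) x₀ (by simp) (by simp)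
      have hux := (hunits hu).1
      exact (((h' hux hx₀ _ (hleft _)).2 i).2 (u i)).2 (C.point_num _ hux i))
    (fun u hu i => by
      obtain ⟨hunits, h'⟩ := h (Sum.elim 0 u) x₀ (fun i => x₀ i + u i) (by simp) (by simp)
      have hux := (hunits hu).2
      exact (((h' hx₀ hux _ (hright _)).2 i).2 (u i)).2 (C.point_num _ hux i))
  have haeval : ∀ x : σ → F₀, aeval x C.q = eval x (MvPolynomial.map (algebraMap k F₀) C.q) :=
    fun x => by rw [MvPolynomial.eval_map, MvPolynomial.aeval_def]
  obtain ⟨N₂, hN₂⟩ := exists_eval_eq_pow_mul_of_close hyp.irreducible_R₀ x₀ 0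
    (MvPolynomial.map (algebraMap k F₀) C.q) (map_zero _) (by rw [← haeval]; exact hx₀.ne_zero) 0
  refine ⟨N₁ + N₂, fun a f hf hfa => ?_⟩
  have hxa : IsUnit (aeval (fun i => x₀ i + algebraMap R₀ F₀ (t ^ (N₁ + N₂) * a i)) C.q) := by
    obtain ⟨r, hr, -⟩ := hN₂ (N₁ + N₂) (Nat.le_add_left _ _) a
    rw [haeval]
    exact hr.isUnit
  obtain ⟨v, w, hv, hw, hs, hvw⟩ := hN₁ fun i => t ^ N₂ * a i
  obtain ⟨hunits, h'⟩ := h (Sum.elim (algebraMap R₀ F₀ ∘ v) (algebraMap R₀ F₀ ∘ w))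
    (fun i => x₀ i + algebraMap R₀ F₀ (v i)) (fun i => x₀ i + algebraMap R₀ F₀ (w i))
    (by simp) (by simp)
  obtain ⟨hxv, hxw⟩ := hunits hs
  refine ⟨v, w, hxv, hxw, hv, hw, ?_⟩
  obtain ⟨hiff, hcoord⟩ := h' hxv hxw _ (toConv_ofConv _)
  rw [C.eq_point f _ hfa hf hxa, ← C.eq_point _ _ (fun i => ?_) (hiff.1 hs) hxa]
  rw [pow_add, mul_assoc (_ ^ N₁)]
  exact ((hcoord i).2 _).1 (hvw i).2

/-- If the translate by `γ` of a chart point `P` is again in the chart, then the translates by `γ`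
of the points close to `P` are close to that of `P`. -/
theorem exists_translate_close {α : ℝ} (hα : 1 < α) {ϖ : R₀} (hϖ : Irreducible ϖ) {S : Set F₀}
    (hS : IsAdicallyDense R₀ α S) (x₀ y₀ : σ → F₀) (hx₀ : IsUnit (aeval x₀ C.q))
    (hy₀ : IsUnit (aeval y₀ C.q)) (hden : C.point x₀ hx₀ C.den ≠ 0)
    (γ : WithConv (A →ₐ[k] F₀))
    (hγ : toConv (C.point y₀ hy₀) * γ = toConv (C.point x₀ hx₀)) (N : ℕ) :
    ∃ (y : σ → F₀) (hy : IsUnit (aeval y C.q)) (r : σ → R₀), (∀ i, y i ∈ S) ∧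
      (toConv (C.point y hy) * γ).ofConv C.den ≠ 0 ∧
      ∀ i, (toConv (C.point y hy) * γ).ofConv (C.num i) =
        (x₀ i + algebraMap R₀ F₀ (ϖ ^ N * r i)) * (toConv (C.point y hy) * γ).ofConv C.den := by
  have := Fintype.ofFinite σ
  obtain ⟨p, q, s, h⟩ := C.exists_coordinate_polynomials X (fun i => MvPolynomial.C (x₀ i))
    (γ * convInverse (toConv (C.point x₀ hx₀))) x₀
  have hprod : ∀ f : WithConv (A →ₐ[k] F₀),
      f * (γ * convInverse (toConv (C.point x₀ hx₀))) * toConv (C.point x₀ hx₀) = f * γ := by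
    intro f
    rw [mul_assoc, mul_assoc, convInverse_mul, mul_one]
  obtain ⟨hs₀, h₀⟩ := (h y₀ y₀ x₀ (by simp) (by simp)).2 hy₀ hx₀ (C.point x₀ hx₀)
    (by rw [hprod, hγ])
  choose M hM using fun i => exists_eval_eq_pow_mul_of_close hϖ y₀ (p i) (q i)
    (by
      have := ((h₀ i).2 0).2 (by rw [add_zero]; exact C.point_num _ hx₀ i)
      rwa [zero_mul] at this)
    ((h₀ i).1 hden) N
  obtain ⟨M', hM'⟩ := exists_eval_eq_pow_mul_of_close hϖ y₀ 0 s (map_zero _) (hs₀.2 hden) 0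
  let L := Finset.univ.sup M ⊔ M'
  have hy : ∀ i, ∃ y ∈ S, ∃ x : R₀, y = y₀ i + algebraMap R₀ F₀ (ϖ ^ L * x) := by
    intro i
    obtain ⟨y, hyS, hy⟩ := hS (y₀ i) (α ^ (-(L : ℤ))) (zpow_pos (by linarith) _)
    obtain ⟨r, hr⟩ := exists_eq_pow_mul_of_adicNorm_le hα hϖ L hy.le
    refine ⟨y, hyS, -r, ?_⟩
    rw [map_mul, map_neg, map_pow, mul_neg, ← hr]
    ring
  choose y hyS x hyx using hy
  obtain rfl : y = fun i => y₀ i + algebraMap R₀ F₀ (ϖ ^ L * x i) := funext hyx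
  obtain ⟨-, hsL, -⟩ := hM' L le_sup_right x
  choose r hqL hpL using fun i =>
    hM i L ((Finset.le_sup (Finset.mem_univ i)).trans le_sup_left) x
  obtain ⟨hunits, h'⟩ := h _ _ x₀ (fun i => eval_X i) (by simp)
  obtain ⟨hiff, hcoord⟩ := h' (hunits hsL).1 hx₀
    (toConv (C.point _ (hunits hsL).1) * γ).ofConv (by rw [hprod, toConv_ofConv])
  exact ⟨_, (hunits hsL).1, r, hyS, hiff.1 hsL, fun i => ((hcoord i).2 _).1 (hpL i)⟩

end RationalChart

/-- Factorization in rational connected linear algebraic groups. -/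
theorem AdditiveDecomposition.exists_factorization {R₀ F₀ : Type*} [CommRing R₀] [IsDomain R₀]
    [IsDiscreteValuationRing R₀] [Field F₀] [Algebra R₀ F₀] [IsFractionRing R₀ F₀]
    {T : Subring R₀} {t : T} {F₁ F₂ : Subfield F₀} {V W : Submodule T R₀}
    (hyp : AdditiveDecomposition T t F₁ F₂ V W) {α : ℝ} (hα : 1 < α)
    (F : Subfield F₀) (hF₁ : F ≤ F₁) (hF₂ : F ≤ F₂) (hT : ∀ x ∈ T, algebraMap R₀ F₀ x ∈ F)
    (hdense : IsAdicallyDense R₀ α (F₁ : Set F₀))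
    (A : Type*) [CommRing A] [HopfAlgebra F A] (hG : IsRationalConnectedGroup F A)
    (g : GroupPoints F A F₀) :
    ∃ (g₁ : GroupPoints F A (Subfield.extendScalars hF₁))
      (g₂ : GroupPoints F A (Subfield.extendScalars hF₂)),
      GroupPoints.map (Subfield.extendScalars hF₁).val g₁ *
        GroupPoints.map (Subfield.extendScalars hF₂).val g₂ = g := by
  have := hG.finiteType
  obtain ⟨n, ⟨C⟩⟩ := hG.rational.exists_rationalChart
  have : Infinite T := infinite_of_irreducible hyp.irreducible_T
  have : Infinite F := Infinite.of_injective
    (fun x : T => (⟨algebraMap R₀ F₀ x, hT x x.2⟩ : F)) fun x y hxy =>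
      Subtype.ext (IsFractionRing.injective R₀ F₀ (congrArg Subtype.val hxy))
  have hbase : ∀ (x : Fin n → F) (hx : IsUnit (aeval x C.q)),
      ∃ hx' : IsUnit (aeval (fun i => (x i : F₀)) C.q),
        convMap (Algebra.ofId F F₀) (toConv (C.point x hx)) = toConv (C.point _ hx') := by
    intro x hx
    have hx' : IsUnit (aeval (fun i => (x i : F₀)) C.q) := by
      have h := hx.map (Algebra.ofId F F₀)
      rwa [MvPolynomial.comp_aeval_apply] at h
    exact ⟨hx', WithConv.ext (C.comp_point (Algebra.ofId F F₀) _ _ _ _ fun _ => rfl)⟩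
  obtain ⟨x, hx, hxden⟩ := C.exists_point_ne_zero C.den_ne_zero
  obtain ⟨hx₀, hxmap⟩ := hbase x hx
  have hden : C.point _ hx₀ C.den ≠ 0 := by
    have h := congrArg (fun f => f.ofConv C.den) hxmap
    exact h ▸ (map_ne_zero_iff _ (Algebra.ofId F F₀).toRingHom.injective).2 hxden
  obtain ⟨d, hd, hchart⟩ := C.exists_ne_zero_forall_eq_point (E := F₀)
  set h₀ := toConv (C.point _ hx₀) with hh₀
  obtain ⟨z, hz, hzd⟩ := C.exists_translate_ne_zero (h₀ * convInverse g) hd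
  obtain ⟨hz₀, hzmap⟩ := hbase z hz
  rw [hzmap] at hzd
  set h := toConv (C.point _ hz₀) with hh
  obtain ⟨y₀, hy₀, hy₀eq⟩ := hchart _ hzd
  have hγ : toConv (C.point y₀ hy₀) * (convInverse h * g) = h₀ := by
    rw [← hy₀eq, toConv_ofConv, mul_assoc, mul_convInverse_cancel_left, mul_assoc,
      convInverse_mul, mul_one]
  obtain ⟨N, hN⟩ := C.exists_point_mul_point hyp _ hx₀ hden
  obtain ⟨y, hy, r, hyF, hyden, hynum⟩ := C.exists_translate_close hα hyp.irreducible_R₀ hdense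
    _ y₀ hx₀ hy₀ hden _ hγ N
  obtain ⟨v, w, hv, hw, hvV, hwW, hfac⟩ := hN r _ hyden hynum
  rw [toConv_ofConv] at hfac
  have hF₁' : ∀ a : F, (a : F₀) ∈ Subfield.extendScalars hF₁ := fun a => hF₁ a.2
  have hF₂' : ∀ a : F, (a : F₀) ∈ Subfield.extendScalars hF₂ := fun a => hF₂ a.2
  have d₁ : IsDefinedOver (Subfield.extendScalars hF₁) (h * (convInverse (toConv (C.point y hy)) *
      (toConv (C.point _ hv) * convInverse h₀))) :=
    (C.isDefinedOver_point _ hz₀ fun i => hF₁' _).mul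
      ((C.isDefinedOver_point y hy hyF).convInverse.mul
        ((C.isDefinedOver_point _ hv fun i => add_mem (hF₁' _) (hyp.V_le_F₁ _ (hvV i))).mul
          (C.isDefinedOver_point _ hx₀ fun i => hF₁' _).convInverse))
  have d₂ : IsDefinedOver (Subfield.extendScalars hF₂) (toConv (C.point _ hw)) :=
    C.isDefinedOver_point _ hw fun i => add_mem (hF₂' _) (hyp.W_le_F₂ _ (hwW i))
  obtain ⟨g₁, hg₁⟩ := d₁
  obtain ⟨g₂, hg₂⟩ := d₂
  refine ⟨g₁, g₂, ?_⟩
  rw [hg₁, hg₂, mul_assoc, mul_assoc, ← hfac, convInverse_mul_cancel_left,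
    mul_convInverse_cancel_left]

end Factorization

theorem theorem3p2 {R₀ F₀ : Type*} [CommRing R₀] [IsDomain R₀] [IsDiscreteValuationRing R₀]
    [Field F₀] [Algebra R₀ F₀] [IsFractionRing R₀ F₀] (α : ℝ) (hα : 1 < α)
    (T : Subring R₀) (t : T) (F₁ F₂ : Subfield F₀) (V W : Submodule T R₀)
    (hyp : AdditiveDecomposition T t F₁ F₂ V W) :
    -- decomposition of small vectors by rational maps
    (∀ (n : ℕ) (f : Fin n → FractionRing (MvPolynomial (Fin n ⊕ Fin n) F₀))
      (U : TopologicalSpace.Opens (PrimeSpectrum (MvPolynomial (Fin n ⊕ Fin n) F₀))),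
      (∀ i, IsRegularOn (f i) U) →
      MvPolynomial.pointToPoint (Sum.elim (0 : Fin n → F₀) 0) ∈ U →
      (∀ u : Fin n → F₀, MvPolynomial.pointToPoint (Sum.elim u 0) ∈ U →
        ∀ i, HasValueAt (f i) (Sum.elim u 0) (u i)) →
      (∀ u : Fin n → F₀, MvPolynomial.pointToPoint (Sum.elim 0 u) ∈ U →
        ∀ i, HasValueAt (f i) (Sum.elim 0 u) (u i)) →
      ∃ ε : ℝ, 0 < ε ∧ ∀ a : Fin n → F₀, adicVecNorm R₀ α a ≤ ε →
        ∃ v w : Fin n → R₀, (∀ i, v i ∈ V) ∧ (∀ i, w i ∈ W) ∧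
          MvPolynomial.pointToPoint
            (Sum.elim (algebraMap R₀ F₀ ∘ v) (algebraMap R₀ F₀ ∘ w)) ∈ U ∧
          ∀ i, HasValueAt (f i)
            (Sum.elim (algebraMap R₀ F₀ ∘ v) (algebraMap R₀ F₀ ∘ w)) (a i)) ∧
    -- factorization in rational connected linear algebraic groups
    (∀ (F : Subfield F₀) (hF₁ : F ≤ F₁) (hF₂ : F ≤ F₂),
      (∀ x ∈ T, algebraMap R₀ F₀ x ∈ F) →
      IsAdicallyDense R₀ α (F₁ : Set F₀) →
      ∀ (A : Type*) [CommRing A] [HopfAlgebra F A], IsRationalConnectedGroup F A →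
      ∀ g : GroupPoints F A F₀,
        ∃ (g₁ : GroupPoints F A (Subfield.extendScalars hF₁))
          (g₂ : GroupPoints F A (Subfield.extendScalars hF₂)),
          GroupPoints.map (Subfield.extendScalars hF₁).val g₁ *
            GroupPoints.map (Subfield.extendScalars hF₂).val g₂ = g) := by
  refine ⟨fun n f U hf h0 h₁ h₂ => hyp.exists_of_rationalMap hα n f U hf h0 h₁ h₂, ?_⟩
  intro F hF₁ hF₂ hT hdense A _ _ hG g
  exact hyp.exists_factorization hα F hF₁ hF₂ hT hdense A hG g
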